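/- All systems are invertible probability measure-preserving systems $(X,\mathcal B,\mu,T)$ on standard Borel spaces. For a sequence $A=(t_n)_{n\ge 1}$ of non-negative integers and a finite measurable partition $\xi$ put $h^A(T,\xi)=\limsup_{n\to\infty}\frac1n H\big(\bigvee_{k=1}^n T^{-t_k}\xi\big)$, where $H$ is Shannon entropy, and let $h^A(T)=\sup_\xi h^A(T,\xi)$, the supremum being over all finite measurable partitions. The system is called a rank one system with tower heights $(h_n)_{n\ge 0}$ if there are integers $q_n\ge 2$ and $a_{n,i}\ge 0$ ($n\ge 0$, $1\le i\le q_n-1$) such that, with $a_n=\sum_{i=1}^{q_n-1}a_{n,i}$, one has $h_0=1$, $h_{n+1}=q_nh_n+a_n$ and $\sum_n a_n/h_{n+1}<\infty$, and measurable sets $F_n$, $F_{n,i}$ ($1\le i\le q_n$) and $C_{n,i,j}$ ($1\le i\le q_n-1$, $1\le j\le a_{n,i}$) such that for all $n$: (a) the sets $T^kF_n$, $0\le k\le h_n-1$, are pairwise disjoint; (b) $F_{n,1},\dots,F_{n,q_n}$ partition $F_n$, and $F_{n+1}=F_{n,1}$; (c) for $1\le i\le q_n-1$: $T^{h_n}F_{n,i}=C_{n,i,1}$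 if $a_{n,i}>0$ and $T^{h_n}F_{n,i}=F_{n,i+1}$ if $a_{n,i}=0$; moreover $TC_{n,i,j}=C_{n,i,j+1}$ for $1\le j<a_{n,i}$ and $TC_{n,i,j}=F_{n,i+1}$ for $j=a_{n,i}\ge 1$; (d) the towers approach the point partition: for every measurable set $B$ and every $\varepsilon>0$, for all sufficiently large $n$ there is a union $U$ of sets among $T^kF_n$, $0\le k\le h_n-1$, with $\mu(B\,\triangle\,U)<\varepsilon$. **Theorem.** (i) Let $\alpha,\beta>0$ with $\alpha\ge 1+1/\beta$ and let $A=(\lfloor n^\alpha\rfloor)_{n\ge1}$. Then there is a rank one system with tower heights $h_n$ such that $h^A(T)>0$ and $$\limsup_{n\to\infty}\frac{\log h_{n+1}}{h_n^{\beta}}<\infty .$$ (ii) Let $\alpha,\beta>0$ with $\alpha\ge 1/\beta$ and let $A=(\lfloor n(\log n)^\alpha\rfloor)_{n\ge1}$. Then there is a rank one system with tower heights $h_n$ such that $h^A(T)>0$ and $$\limsup_{n\to\infty}\frac{\log h_{n+1}}{e^{h_n^{\beta}}}<\infty .$$ -/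

import Mathlib

open MeasureTheory Filter Topology

noncomputable section

/-- Shannon entropy (natural logarithm) of the finite partition of `X` into the fibres of a map
`φ : X → ι`, where `ι` is finite: the sum of `-μ(P) log μ(P)` over the cells `P = φ⁻¹{i}`. -/
def partitionEntropy {X ι : Type*} [MeasurableSpace X] [Fintype ι] (μ : Measure X)
    (φ : X → ι) : ℝ :=
  ∑ i : ι, Real.negMulLog (μ.real (φ ⁻¹' {i}))

/-- Coding map of the join `⋁_{k=1}^n T^{-t_k} ξ`, where the partition `ξ` is given by its
coding map `φ`: the point `x` is sent to the word `φ(T^{t_1} x) ⋯ φ(T^{t_n} x)`. -/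
def sequenceCoding {X ι : Type*} (T : X → X) (t : ℕ → ℕ) (φ : X → ι) (n : ℕ) :
    X → (Fin n → ι) :=
  fun x k => φ (T^[t ((k : ℕ) + 1)] x)

/-- Sequence entropy `h^A(T, ξ)` along `A = (t_n)_{n ≥ 1}` with respect to the partition `ξ` into
the fibres of `φ`. -/
def sequenceEntropyPartition {X ι : Type*} [MeasurableSpace X] [Fintype ι] (μ : Measure X)
    (T : X → X) (t : ℕ → ℕ) (φ : X → ι) : EReal :=
  limsup (fun n : ℕ =>
    ((1 / (n : ℝ) * partitionEntropy μ (sequenceCoding T t φ n) : ℝ) : EReal)) atTop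

/-- Sequence entropy `h^A(T)` along `A = (t_n)_{n ≥ 1}`: the supremum of `h^A(T, ξ)` over all
finite measurable partitions `ξ`, each given by a measurable coding map `X → {0, …, m - 1}`. -/
def sequenceEntropy {X : Type*} [MeasurableSpace X] (μ : Measure X) (T : X → X)
    (t : ℕ → ℕ) : EReal :=
  ⨆ (m : ℕ) (φ : X → Fin m) (_ : Measurable φ), sequenceEntropyPartition μ T t φ

/-- Total number `a_n = ∑_{i=1}^{q_n - 1} a_{n,i}` of spacers added at step `n`. -/
def spacerCount (q : ℕ → ℕ) (a : ℕ → ℕ → ℕ) (n : ℕ) : ℕ :=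
  ∑ i ∈ Finset.Ico 1 (q n), a n i

/-- Tower heights: `h_0 = 1` and `h_{n+1} = q_n h_n + a_n`. -/
def towerHeight (q : ℕ → ℕ) (a : ℕ → ℕ → ℕ) : ℕ → ℕ
  | 0 => 1
  | n + 1 => q n * towerHeight q a n + spacerCount q a n

/-- `T` is obtained by cutting and stacking with stacking data `(q_n; a_{n,i})`. Here `F n` is the
base of the `n`-th tower, `G n i` (for `1 ≤ i ≤ q n`) are the slices of `F n`, and `C n i j`
(for `1 ≤ i < q n` and `1 ≤ j ≤ a n i`) is the `j`-th spacer level put above the `i`-th slice of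
the `n`-th tower. -/
structure IsCutAndStack {X : Type*} [MeasurableSpace X] (μ : Measure X) (T : X ≃ᵐ X)
    (q : ℕ → ℕ) (a : ℕ → ℕ → ℕ) (F : ℕ → Set X) (G : ℕ → ℕ → Set X)
    (C : ℕ → ℕ → ℕ → Set X) : Prop where
  two_le_q : ∀ n, 2 ≤ q n
  summable_spacers :
    Summable fun n : ℕ => (spacerCount q a n : ℝ) / (towerHeight q a (n + 1) : ℝ)
  measurable_base : ∀ n, MeasurableSet (F n)
  measurable_slice : ∀ n i, 1 ≤ i → i ≤ q n → MeasurableSet (G n i)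
  measurable_spacer : ∀ n i j, 1 ≤ i → i < q n → 1 ≤ j → j ≤ a n i → MeasurableSet (C n i j)
  /-- The levels `T^k F_n`, `0 ≤ k < h_n`, are pairwise disjoint. -/
  disjoint_levels : ∀ n k l, k < towerHeight q a n → l < towerHeight q a n → k ≠ l →
    Disjoint ((⇑T)^[k] '' F n) ((⇑T)^[l] '' F n)
  /-- The slices `F_{n,1}, …, F_{n,q_n}` partition the base `F_n`. -/
  slices_cover : ∀ n, ⋃ i ∈ Finset.Icc 1 (q n), G n i = F n
  slices_disjoint : ∀ n i j, 1 ≤ i → i ≤ q n → 1 ≤ j → j ≤ q n → i ≠ j →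
    Disjoint (G n i) (G n j)
  glue_slice : ∀ n i, 1 ≤ i → i < q n →
    (⇑T)^[towerHeight q a n] '' G n i = if 0 < a n i then C n i 1 else G n (i + 1)
  glue_spacer : ∀ n i j, 1 ≤ i → i < q n → 1 ≤ j → j ≤ a n i →
    ⇑T '' C n i j = if j < a n i then C n i (j + 1) else G n (i + 1)
  base_succ : ∀ n, F (n + 1) = G n 1
  /-- The towers converge to the point partition: every measurable set is, up to arbitrarily
  small measure, a union of levels of the `n`-th tower, for all large `n`. -/
  generating : ∀ B : Set X, MeasurableSet B → ∀ ε : ℝ, 0 < ε → ∀ᶠ n in atTop,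
    ∃ s : Finset ℕ, s ⊆ Finset.range (towerHeight q a n) ∧
      μ.real (symmDiff B (⋃ k ∈ s, (⇑T)^[k] '' F n)) < ε

/-- `(X, μ, T)` is a rank one system, that is, an invertible probability measure-preserving system
obtained by cutting and stacking, and `h` is the sequence of heights of its towers. -/
def IsRankOneSystem {X : Type*} [MeasurableSpace X] (μ : Measure X) (T : X ≃ᵐ X)
    (h : ℕ → ℕ) : Prop :=
  IsProbabilityMeasure μ ∧ MeasurePreserving T μ μ ∧
    ∃ (q : ℕ → ℕ) (a : ℕ → ℕ → ℕ) (F : ℕ → Set X) (G : ℕ → ℕ → Set X)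
      (C : ℕ → ℕ → ℕ → Set X),
      IsCutAndStack μ T q a F G C ∧ h = towerHeight q a

end

/-! The system is a tower over the 2-adic odometer y ↦ y + 1, with at most one spacer inserted below
each point. A tower of height h is cut into columns grouped in pairs, and each pair receives exactly
one spacer, below its first or its second column. Such a superblock has length P = 2h + 1 whatever
the choice, so superblocks start at multiples of P. Yet the choice can be read off: it shifts the
first column by one step, and consecutive orbit points always have different codes
(`orbitCode_succ_ne`, `orbitCode_superblock`). The successive choices spell all binary words of
length W = 2V, one after the other, except for their first letters.

Start at offset u of a superblock in the first half of the word b. If t advances by at least P every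
four indices from K on, and t(5K) ≤ VP, then the K times t(K + 4i) visit distinct superblocks of the
same word. Each visit whose residue modulo P lies in [1, h) reveals one bit of b. Averaging over u,
a fixed proportion of the visits is of this kind, so letting b vary yields entropy at least a
constant times K from 5K observations (`partitionEntropy_sequenceCoding_ge`). The different starting
positions are combined by concavity of entropy (`sum_mul_sum_negMulLog_le`); the levels used are a
fixed proportion of the tower.

The price is h' = W 2^W (2h + 1) for the next height h', hence log h' is at most of order V + log h.
For t(k) = ⌊k g(k)⌋ one takes K with g(K) comparable to h, and V comparable to K
(`exists_rankOneSystem_floor`). With g(k) = k^(α-1) this gives K of order h^(1/(α-1)) ≤ h^β; with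
g(k) = (log k)^α it gives K of order exp(h^(1/α)) ≤ exp(h^β). -/

/-- The Borel structure of the 2-adic integers. -/
noncomputable instance PadicInt.two.measurableSpace : MeasurableSpace ℤ_[2] := borel _

instance PadicInt.two.borelSpace : BorelSpace ℤ_[2] := ⟨rfl⟩

/-! ### Residue classes and Haar measure of the 2-adic integers. -/

namespace TwoAdicTower

/-- Residue in `[0, 2 ^ m)` of a 2-adic integer modulo `2 ^ m`. -/
noncomputable def res (m : ℕ) (y : ℤ_[2]) : ℕ := (PadicInt.toZModPow m y).val

theorem res_lt (m : ℕ) (y : ℤ_[2]) : res m y < 2 ^ m := ZMod.val_lt _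

theorem res_add (m : ℕ) (y z : ℤ_[2]) : res m (y + z) = (res m y + res m z) % 2 ^ m := by
  simp [res, ZMod.val_add]

theorem res_natCast (m k : ℕ) : res m (k : ℤ_[2]) = k % 2 ^ m := by
  simp only [res, map_natCast, ZMod.val_natCast]

theorem res_add_natCast (m k : ℕ) (y : ℤ_[2]) : res m (y + k) = (res m y + k) % 2 ^ m := by
  rw [res_add, res_natCast, Nat.add_mod_mod]

theorem res_zero (m : ℕ) : res m 0 = 0 := by simp [res]

theorem res_mod {m n : ℕ} (h : m ≤ n) (y : ℤ_[2]) : res n y % 2 ^ m = res m y := by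
  have := PadicInt.cast_toZModPow m n h y
  unfold res
  rw [← this, ZMod.cast_eq_val, ZMod.val_natCast]

theorem res_eq_iff_norm (m : ℕ) (y z : ℤ_[2]) :
    res m y = res m z ↔ ‖y - z‖ ≤ (2 : ℝ) ^ (-(m : ℤ)) := by
  have h := PadicInt.norm_le_pow_iff_mem_span_pow (p := 2) (y - z) m
  rw [← PadicInt.ker_toZModPow, RingHom.mem_ker, map_sub, sub_eq_zero] at h
  unfold res
  rw [(ZMod.val_injective (2 ^ m)).eq_iff, ← h]
  norm_num

theorem isOpen_res_eq (m r : ℕ) : IsOpen {y : ℤ_[2] | res m y = r} := by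
  rw [Metric.isOpen_iff]
  intro y hy
  refine ⟨(2 : ℝ) ^ (-(m : ℤ)), by positivity, fun z hz => ?_⟩
  have : res m z = res m y := (res_eq_iff_norm m z y).2 (by
    rw [Metric.mem_ball, dist_eq_norm] at hz
    exact hz.le)
  exact this.trans hy

theorem measurable_res (m : ℕ) : Measurable (res m) :=
  measurable_to_countable' fun r => (isOpen_res_eq m r).measurableSet

theorem measurableSet_res_eq (m r : ℕ) : MeasurableSet {y : ℤ_[2] | res m y = r} :=
  (isOpen_res_eq m r).measurableSet

/-- The normalized Haar measure of the 2-adic integers. -/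
noncomputable def haar : Measure ℤ_[2] := Measure.addHaarMeasure ⊤

instance : IsProbabilityMeasure haar :=
  ⟨by have := Measure.addHaarMeasure_self (K₀ := (⊤ : TopologicalSpace.PositiveCompacts ℤ_[2]))
      simpa [haar] using this⟩

instance : haar.IsAddHaarMeasure := by unfold haar; infer_instance

theorem haar_real_preimage_add (a : ℤ_[2]) (s : Set ℤ_[2]) :
    haar.real ((fun y => y + a) ⁻¹' s) = haar.real s := by
  simp [Measure.real, measure_preimage_add_right]

/-- The 2 ^ m classes are translates of one another and partition a space of mass one. -/
theorem haar_res_eq (m r : ℕ) (hr : r < 2 ^ m) :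
    haar.real {y | res m y = r} = 1 / 2 ^ m := by
  have h0 : ∀ s < 2 ^ m, haar.real {y | res m y = s} = haar.real {y | res m y = 0} := by
    intro s hs
    rw [← haar_real_preimage_add (s : ℤ_[2]) {y | res m y = s}]
    congr 1
    ext y
    simp only [Set.mem_preimage, Set.mem_ofPred_eq, res_add_natCast]
    have hy := res_lt m y
    constructor
    · intro h
      by_contra hne
      rcases Nat.lt_or_ge (res m y + s) (2 ^ m) with h1 | h1
      · rw [Nat.mod_eq_of_lt h1] at h; omega
      · rw [Nat.mod_eq_sub_mod h1, Nat.mod_eq_of_lt (by omega)] at h; omega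
    · intro h
      rw [h, zero_add, Nat.mod_eq_of_lt hs]
  have hsum : ∑ s ∈ Finset.range (2 ^ m), haar.real {y | res m y = s} = 1 := by
    rw [← measureReal_biUnion_finset]
    · have : (⋃ s ∈ Finset.range (2 ^ m), {y | res m y = s}) = Set.univ := by
        ext y; simp [res_lt]
      rw [this]; simp
    · intro s _ s' _ hss
      refine Set.disjoint_left.2 fun y h1 h2 => hss (h1.symm.trans h2)
    · intro s _; exact measurableSet_res_eq m s
  rw [Finset.sum_congr rfl (fun s hs => h0 s (Finset.mem_range.1 hs))] at hsum
  rw [h0 r hr]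
  simp only [Finset.sum_const, Finset.card_range, nsmul_eq_mul, Nat.cast_pow, Nat.cast_ofNat]
    at hsum
  field_simp
  linarith

/-- Every Borel set of 2-adic integers is approximated by unions of residue classes. -/
theorem exists_finset_symmDiff_lt (B : Set ℤ_[2]) (hB : MeasurableSet B) (ε : ℝ) (hε : 0 < ε) :
    ∃ m₀, ∀ m ≥ m₀, ∃ R : Finset ℕ, haar.real (symmDiff B {y | res m y ∈ R}) < ε := by
  classical
  have hε' : ENNReal.ofReal (ε / 2) ≠ 0 := by
    rw [Ne, ENNReal.ofReal_eq_zero]; linarith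
  obtain ⟨K, hKB, hKc, hK⟩ := hB.exists_isCompact_lt_add (measure_ne_top haar B) hε'
  obtain ⟨U, hBU, hUo, hU⟩ := B.exists_isOpen_lt_add (μ := haar) (measure_ne_top haar B) hε'
  obtain ⟨δ, hδ, hth⟩ := hKc.exists_thickening_subset_open hUo (hKB.trans hBU)
  obtain ⟨m₀, hm₀⟩ := exists_pow_lt_of_lt_one hδ (by norm_num : (1 / 2 : ℝ) < 1)
  refine ⟨m₀, fun m hm => ?_⟩
  refine ⟨(Finset.range (2 ^ m)).filter (fun r => ∃ z ∈ K, res m z = r), ?_⟩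
  have hKR : K ⊆ {y | res m y ∈ (Finset.range (2 ^ m)).filter (fun r => ∃ z ∈ K, res m z = r)} := by
    intro y hy
    simp only [Finset.mem_filter, Finset.mem_range, Set.mem_ofPred_eq]
    exact ⟨res_lt m y, y, hy, rfl⟩
  have hRU : {y | res m y ∈ (Finset.range (2 ^ m)).filter (fun r => ∃ z ∈ K, res m z = r)} ⊆ U := by
    intro y hy
    simp only [Finset.mem_filter, Finset.mem_range, Set.mem_ofPred_eq] at hy
    obtain ⟨_, z, hz, hzy⟩ := hy
    apply hth
    rw [Metric.mem_thickening_iff]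
    refine ⟨z, hz, ?_⟩
    rw [dist_eq_norm]
    refine ((res_eq_iff_norm m y z).1 hzy.symm).trans_lt (lt_of_le_of_lt ?_ hm₀)
    rw [zpow_neg, zpow_natCast, one_div, inv_pow]
    gcongr
    norm_num
  have hsub : symmDiff B {y | res m y ∈
      (Finset.range (2 ^ m)).filter (fun r => ∃ z ∈ K, res m z = r)} ⊆ U \ K := by
    rintro y (⟨h1, h2⟩ | ⟨h1, h2⟩)
    · exact ⟨hBU h1, fun h => h2 (hKR h)⟩
    · exact ⟨hRU h1, fun h => h2 (hKB h)⟩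
  have hUK : haar.real (U \ K) = haar.real U - haar.real K :=
    measureReal_sdiff (hKB.trans hBU) hKc.measurableSet
  have h1 : haar.real U < haar.real B + ε / 2 := by
    have := (ENNReal.toReal_lt_toReal (measure_ne_top _ _)
      (ENNReal.add_ne_top.2 ⟨measure_ne_top _ _, ENNReal.ofReal_ne_top⟩)).2 hU
    rwa [ENNReal.toReal_add (measure_ne_top _ _) ENNReal.ofReal_ne_top,
      ENNReal.toReal_ofReal (by linarith)] at this
  have h2 : haar.real B < haar.real K + ε / 2 := by
    have := (ENNReal.toReal_lt_toReal (measure_ne_top _ _)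
      (ENNReal.add_ne_top.2 ⟨measure_ne_top _ _, ENNReal.ofReal_ne_top⟩)).2 hK
    rwa [ENNReal.toReal_add (measure_ne_top _ _) ENNReal.ofReal_ne_top,
      ENNReal.toReal_ofReal (by linarith)] at this
  have h3 := measureReal_mono hsub (μ := haar) (measure_ne_top _ _)
  linarith

/-! ### The tower map over the odometer and its invariant measure. -/

section Tower

variable (M : ℕ → ℕ) (A : ℕ → ℕ → Bool)

/-- The set of 2-adic integers below which a spacer is inserted: at stage `n`, a spacer is put below
the residue class of `i * 2 ^ M n` modulo `2 ^ M (n + 1)` when `A n i` holds. -/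
def spacerSet : Set ℤ_[2] :=
  {y | ∃ n i, A n i = true ∧ 0 < i ∧ i < 2 ^ (M (n + 1) - M n) ∧ res (M (n + 1)) y = i * 2 ^ M n}

theorem measurableSet_spacerSet : MeasurableSet (spacerSet M A) := by
  have : spacerSet M A = ⋃ (n : ℕ) (i : ℕ) (_ : A n i = true ∧ 0 < i ∧
      i < 2 ^ (M (n + 1) - M n)), {y | res (M (n + 1)) y = i * 2 ^ M n} := by
    ext y
    simp [spacerSet, and_assoc]
  rw [this]
  exact MeasurableSet.iUnion fun n => MeasurableSet.iUnion fun i => MeasurableSet.iUnion fun _ =>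
    measurableSet_res_eq _ _

open Classical in
/-- The tower transformation over the 2-adic odometer: the point `(y, false)` lies in the base, and
`(y, true)`, for `y ∈ spacerSet M A`, is the spacer below it. -/
noncomputable def step (x : ℤ_[2] × Bool) : ℤ_[2] × Bool :=
  -- The superfluous points `(y, true)` with `y` outside the spacer set are fixed. They have measure
  -- zero, and keeping them makes the map a bijection of the whole product.
  if x.2 = true then (x.1, decide (x.1 ∉ spacerSet M A))
  else (x.1 + 1, decide (x.1 + 1 ∈ spacerSet M A))

open Classical in
/-- Inverse of `step`. -/
noncomputable def stepInv (x : ℤ_[2] × Bool) : ℤ_[2] × Bool :=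
  if decide (x.1 ∈ spacerSet M A) = x.2 then (x.1 - 1, false) else (x.1, true)

theorem stepInv_step (x : ℤ_[2] × Bool) : stepInv M A (step M A x) = x := by
  obtain ⟨y, b⟩ := x
  cases b
  · by_cases h : y + 1 ∈ spacerSet M A <;> simp [stepInv, step, h]
  · by_cases h : y ∈ spacerSet M A <;> simp [stepInv, step, h]

theorem step_stepInv (x : ℤ_[2] × Bool) : step M A (stepInv M A x) = x := by
  obtain ⟨y, b⟩ := x
  cases b <;> by_cases h : y ∈ spacerSet M A <;> simp [stepInv, step, h]

theorem measurable_decide_spacerSet {f : ℤ_[2] → ℤ_[2]} (hf : Measurable f) :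
    Measurable fun y => (open Classical in decide (f y ∈ spacerSet M A)) := by
  apply measurable_to_bool
  have : (fun y => (open Classical in decide (f y ∈ spacerSet M A))) ⁻¹' {true} =
      f ⁻¹' spacerSet M A := by ext; simp
  rw [this]
  exact hf (measurableSet_spacerSet M A)

theorem measurable_of_fibers {β : Type*} [MeasurableSpace β] {f : ℤ_[2] × Bool → β}
    (hf : ∀ b, Measurable fun y => f (y, b)) : Measurable f :=
  measurable_from_prod_countable_left hf

theorem measurable_step : Measurable (step M A) := by
  refine measurable_of_fibers fun b => ?_
  cases b
  · simp only [step, Bool.false_eq_true, if_false]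
    exact (measurable_id.add_const 1).prodMk
      (measurable_decide_spacerSet M A (measurable_id.add_const 1))
  · simp only [step, if_true]
    refine measurable_id.prodMk ?_
    have := (measurable_of_countable Bool.not).comp (measurable_decide_spacerSet M A measurable_id)
    convert this using 2 with y
    simp

theorem measurable_stepInv : Measurable (stepInv M A) := by
  refine measurable_of_fibers fun b => ?_
  have hE := measurableSet_spacerSet M A
  refine Measurable.ite ?_ ((measurable_id.sub_const 1).prodMk measurable_const)
    (measurable_id.prodMk measurable_const)
  exact measurable_decide_spacerSet M A measurable_id (measurableSet_singleton b)

/-- The tower transformation as a measurable automorphism. -/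
noncomputable def stepEquiv : (ℤ_[2] × Bool) ≃ᵐ (ℤ_[2] × Bool) where
  toFun := step M A
  invFun := stepInv M A
  left_inv := stepInv_step M A
  right_inv := step_stepInv M A
  measurable_toFun := measurable_step M A
  measurable_invFun := measurable_stepInv M A

/-- Total mass of the tower over the odometer. -/
noncomputable def mass : ℝ := 1 + haar.real (spacerSet M A)

/-- The invariant probability measure of the tower transformation. -/
noncomputable def towerMeasure : Measure (ℤ_[2] × Bool) :=
  ENNReal.ofReal (mass M A)⁻¹ •
    (haar.map (fun y => (y, false)) + (haar.restrict (spacerSet M A)).map (fun y => (y, true)))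

theorem mass_pos : 0 < mass M A := by
  have : 0 ≤ haar.real (spacerSet M A) := measureReal_nonneg
  unfold mass; linarith

theorem one_le_mass : 1 ≤ mass M A := by
  have : 0 ≤ haar.real (spacerSet M A) := measureReal_nonneg
  unfold mass; linarith

theorem mass_le_two : mass M A ≤ 2 := by
  have : haar.real (spacerSet M A) ≤ 1 := measureReal_le_one
  unfold mass; linarith

theorem towerMeasure_apply {B : Set (ℤ_[2] × Bool)} (hB : MeasurableSet B) :
    towerMeasure M A B = ENNReal.ofReal (mass M A)⁻¹ *
      (haar {y | (y, false) ∈ B} + haar ({y | (y, true) ∈ B} ∩ spacerSet M A)) := by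
  have h1 : Measurable fun y : ℤ_[2] => (y, false) := measurable_prodMk_right
  have h2 : Measurable fun y : ℤ_[2] => (y, true) := measurable_prodMk_right
  rw [towerMeasure, Measure.smul_apply, Measure.add_apply, Measure.map_apply h1 hB,
    Measure.map_apply h2 hB, Measure.restrict_apply (h2 hB)]
  rfl

theorem towerMeasure_real {B : Set (ℤ_[2] × Bool)} (hB : MeasurableSet B) :
    (towerMeasure M A).real B = (mass M A)⁻¹ *
      (haar.real {y | (y, false) ∈ B} + haar.real ({y | (y, true) ∈ B} ∩ spacerSet M A)) := by
  rw [Measure.real, towerMeasure_apply M A hB, ENNReal.toReal_mul, ENNReal.toReal_ofReal,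
    ENNReal.toReal_add (measure_ne_top _ _) (measure_ne_top _ _)]
  · rfl
  · exact inv_nonneg.2 (mass_pos M A).le

instance isProbabilityMeasure_towerMeasure : IsProbabilityMeasure (towerMeasure M A) := by
  constructor
  rw [towerMeasure_apply M A MeasurableSet.univ]
  simp only [Set.mem_univ, Set.ofPred_true, Set.univ_inter, measure_univ]
  have : (1 : ENNReal) + haar (spacerSet M A) = ENNReal.ofReal (mass M A) := by
    rw [mass, ENNReal.ofReal_add zero_le_one measureReal_nonneg, ENNReal.ofReal_one,
      ofReal_measureReal]
  rw [this, ← ENNReal.ofReal_mul (inv_nonneg.2 (mass_pos M A).le),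
    inv_mul_cancel₀ (mass_pos M A).ne', ENNReal.ofReal_one]

/-- Points entering `B` from the base correspond, after translation by one, to base points of `B`
without a spacer and to spacers of `B`. Those entering from a spacer account for the remaining base
points. -/
theorem measurePreserving_step :
    MeasurePreserving (stepEquiv M A) (towerMeasure M A) (towerMeasure M A) := by
  refine ⟨(stepEquiv M A).measurable, ?_⟩
  ext B hB
  have h1 : Measurable fun y : ℤ_[2] => (y, false) := measurable_prodMk_right
  have h2 : Measurable fun y : ℤ_[2] => (y, true) := measurable_prodMk_right
  have hE := measurableSet_spacerSet M A
  rw [Measure.map_apply (stepEquiv M A).measurable hB, towerMeasure_apply M A hB,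
    towerMeasure_apply M A ((stepEquiv M A).measurable hB)]
  congr 1
  have e1 : {y | (y, false) ∈ stepEquiv M A ⁻¹' B} = (fun y => y + 1) ⁻¹'
      (({y | (y, false) ∈ B} \ spacerSet M A) ∪ ({y | (y, true) ∈ B} ∩ spacerSet M A)) := by
    ext y
    by_cases h : y + 1 ∈ spacerSet M A <;> simp [stepEquiv, step, h]
  have e2 : {y | (y, true) ∈ stepEquiv M A ⁻¹' B} ∩ spacerSet M A =
      {y | (y, false) ∈ B} ∩ spacerSet M A := by
    ext y
    by_cases h : y ∈ spacerSet M A <;> simp [stepEquiv, step, h]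
  have hBE : MeasurableSet ({y | (y, true) ∈ B} ∩ spacerSet M A) := (h2 hB).inter hE
  rw [e1, e2, measure_preimage_add_right, measure_union _ hBE,
    add_right_comm, measure_sdiff_add_inter _ hE]
  exact Set.disjoint_left.2 fun y h h' => h.2 h'.2

end Tower

/-! ### Orbit of the base point and heights of the towers. -/

section Orbit

variable (M : ℕ → ℕ) (A : ℕ → ℕ → Bool)

/-- Stages from `n` on put spacers only below points of residue zero modulo `2 ^ M n`, and earlier
stages depend only on that residue. -/
theorem mem_spacerSet_congr (hM : StrictMono M) {n : ℕ} {y z : ℤ_[2]}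
    (h : res (M n) y = res (M n) z) (h0 : res (M n) y ≠ 0) :
    y ∈ spacerSet M A ↔ z ∈ spacerSet M A := by
  suffices H : ∀ y z : ℤ_[2], res (M n) y = res (M n) z → res (M n) y ≠ 0 →
      y ∈ spacerSet M A → z ∈ spacerSet M A from
    ⟨H y z h h0, H z y h.symm (h ▸ h0)⟩
  rintro y z h h0 ⟨k, i, hA, hi, hiq, hres⟩
  rcases Nat.lt_or_ge k n with hk | hk
  · refine ⟨k, i, hA, hi, hiq, ?_⟩
    rw [← res_mod (hM.monotone hk) z, ← h, res_mod (hM.monotone hk), hres]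
  · exfalso
    apply h0
    have hkn : M n ≤ M k := hM.monotone hk
    rw [← res_mod (hkn.trans (hM.monotone k.le_succ)) y, hres]
    exact Nat.mod_eq_zero_of_dvd ((pow_dvd_pow 2 hkn).mul_left i)

theorem pow_mul_pow_sub (hM : StrictMono M) (n : ℕ) :
    2 ^ (M (n + 1) - M n) * 2 ^ M n = 2 ^ M (n + 1) := by
  rw [← pow_add, Nat.sub_add_cancel (hM.monotone n.le_succ)]

/-- The stage that can act on a point is determined by the residue: an earlier stage requires a
nonzero residue modulo `2 ^ M n`, a later one a zero residue modulo `2 ^ M (n + 1)`. -/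
theorem mem_spacerSet_stage (hM : StrictMono M) {n i : ℕ} {y : ℤ_[2]} (hi : 0 < i)
    (hiq : i < 2 ^ (M (n + 1) - M n)) (h : res (M (n + 1)) y = i * 2 ^ M n) :
    y ∈ spacerSet M A ↔ A n i = true := by
  refine ⟨?_, fun hA => ⟨n, i, hA, hi, hiq, h⟩⟩
  rintro ⟨k, j, hA, hj, hjq, hres⟩
  rcases Nat.lt_trichotomy k n with hk | rfl | hk
  · exfalso
    rw [← res_mod (hM.monotone (Nat.succ_le_succ hk.le)) y, h,
      Nat.mod_eq_zero_of_dvd ((pow_dvd_pow 2 (hM.monotone hk)).mul_left i)] at hres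
    have : 0 < j * 2 ^ M k := by positivity
    omega
  · rw [h] at hres
    rwa [Nat.eq_of_mul_eq_mul_right (by positivity) hres]
  · exfalso
    have h1 : M (n + 1) ≤ M k := hM.monotone hk
    rw [← res_mod (h1.trans (hM.monotone k.le_succ)) y, hres,
      Nat.mod_eq_zero_of_dvd ((pow_dvd_pow 2 h1).mul_left j)] at h
    have : 0 < i * 2 ^ M n := by positivity
    omega

open Classical in
/-- Number of spacers (zero or one) below the natural number `s`. -/
noncomputable def spacerBit (s : ℕ) : ℕ := if (s : ℤ_[2]) ∈ spacerSet M A then 1 else 0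

/-- Time at which the orbit of `(0, false)` reaches `(r, false)`. -/
noncomputable def pos (r : ℕ) : ℕ := r + ∑ s ∈ Finset.range r, spacerBit M A (s + 1)

open Classical in
/-- The orbit of `(0, false)`. -/
noncomputable def orbit : ℕ → ℕ × Bool
  | 0 => (0, false)
  | p + 1 => if (orbit p).2 = true then ((orbit p).1, false)
      else ((orbit p).1 + 1, decide ((((orbit p).1 + 1 : ℕ) : ℤ_[2]) ∈ spacerSet M A))

/-- Height of the tower over the residue class of zero modulo `2 ^ M n`. -/
noncomputable def height (n : ℕ) : ℕ := pos M A (2 ^ M n - 1) + 1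

theorem pos_add (a b : ℕ) :
    pos M A (a + b) = pos M A a + b + ∑ s ∈ Finset.range b, spacerBit M A (a + s + 1) := by
  simp only [pos, Finset.sum_range_add, add_assoc]
  omega

theorem pos_succ (r : ℕ) : pos M A (r + 1) = pos M A r + 1 + spacerBit M A (r + 1) := by
  simp [pos_add]

theorem pos_strictMono : StrictMono (pos M A) :=
  strictMono_nat_of_lt_succ fun r => by rw [pos_succ]; omega

-- A spacer is visited just before the base point above it, which is why the time of a spacer falls
-- short of `pos` by one.
open Classical in
theorem orbit_spec (p : ℕ) : pos M A (orbit M A p).1 = p + (orbit M A p).2.toNat ∧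
    ((orbit M A p).2 = true → 0 < (orbit M A p).1 ∧
      ((orbit M A p).1 : ℤ_[2]) ∈ spacerSet M A) := by
  induction p with
  | zero => simp [orbit, pos]
  | succ p ih =>
    rw [orbit]
    by_cases h : (orbit M A p).2 = true
    · simp only [h, if_true]
      have := ih.1
      simp only [h, Bool.toNat_true] at this
      simp [this]
    · rw [if_neg h]
      have h1 := ih.1
      simp only [Bool.not_eq_true] at h
      simp only [h, Bool.toNat_false] at h1
      refine ⟨?_, fun hd => ⟨Nat.succ_pos _, by simpa using hd⟩⟩
      rw [pos_succ, spacerBit, h1]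
      by_cases hE : (((orbit M A p).1 + 1 : ℕ) : ℤ_[2]) ∈ spacerSet M A
      · rw [if_pos hE, decide_eq_true hE]; rfl
      · rw [if_neg hE, decide_eq_false hE]; rfl

theorem orbit_injective : Function.Injective (orbit M A) := by
  intro p p' h
  have h1 := (orbit_spec M A p).1
  have h2 := (orbit_spec M A p').1
  rw [h] at h1
  omega

/-- The tower ends at the base point of index `2 ^ M n - 1`, so a spacer below index `2 ^ M n`
already lies outside it. -/
theorem orbit_fst_lt {n p : ℕ} (hp : p < height M A n) : (orbit M A p).1 < 2 ^ M n := by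
  by_contra hcon
  push Not at hcon
  have hQ : 0 < 2 ^ M n := by positivity
  obtain ⟨h1, h2⟩ := orbit_spec M A p
  unfold height at hp
  obtain ⟨r, hr⟩ : ∃ r, (orbit M A p).1 = r + 1 := ⟨(orbit M A p).1 - 1, by omega⟩
  have hmono : pos M A (2 ^ M n - 1) ≤ pos M A r := (pos_strictMono M A).monotone (by omega)
  rw [hr, pos_succ] at h1
  cases hb : (orbit M A p).2
  · simp only [hb, Bool.toNat_false] at h1; omega
  · have h3 := (h2 hb).2
    rw [hr] at h3
    simp only [hb, Bool.toNat_true, spacerBit, h3, if_true] at h1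
    omega

theorem orbit_pos (r : ℕ) : orbit M A (pos M A r) = (r, false) := by
  induction r with
  | zero => simp [pos, orbit]
  | succ r ih =>
    by_cases hE : ((r + 1 : ℕ) : ℤ_[2]) ∈ spacerSet M A
    · have : pos M A (r + 1) = pos M A r + 1 + 1 := by rw [pos_succ, spacerBit, if_pos hE]
      rw [this, orbit, orbit, ih]
      simp at hE
      simp [hE]
    · have : pos M A (r + 1) = pos M A r + 1 := by rw [pos_succ, spacerBit, if_neg hE]
      rw [this, orbit, ih]
      simp at hE
      simp [hE]

/-- While the orbit climbs the tower its residue modulo `2 ^ M n` is nonzero after the start, so by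
`mem_spacerSet_congr` it meets the same spacers as the orbit of zero. -/
theorem iterate_step (hM : StrictMono M) {n p : ℕ} (hp : p < height M A n) {y : ℤ_[2]}
    (hy : res (M n) y = 0) :
    (step M A)^[p] (y, false) = (y + (orbit M A p).1, (orbit M A p).2) := by
  induction p with
  | zero => simp [orbit]
  | succ p ih =>
    have hlt := orbit_fst_lt M A hp
    rw [Function.iterate_succ_apply', ih (by omega)]
    rw [orbit] at hlt ⊢
    by_cases h : (orbit M A p).2 = true
    · have hE := ((orbit_spec M A p).2 h)
      have hlt' : (orbit M A p).1 < 2 ^ M n := orbit_fst_lt M A (by omega)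
      have : y + ((orbit M A p).1 : ℤ_[2]) ∈ spacerSet M A := by
        rw [mem_spacerSet_congr M A hM (n := n) (z := ((orbit M A p).1 : ℤ_[2]))]
        · exact hE.2
        · rw [res_add_natCast, res_natCast, hy, zero_add]
        · rw [res_add_natCast, hy, zero_add, Nat.mod_eq_of_lt hlt']
          exact hE.1.ne'
      simp [step, h, this]
    · rw [if_neg h] at hlt
      simp only at hlt
      have : y + (((orbit M A p).1 + 1 : ℕ) : ℤ_[2]) ∈ spacerSet M A ↔
          (((orbit M A p).1 + 1 : ℕ) : ℤ_[2]) ∈ spacerSet M A := by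
        apply mem_spacerSet_congr M A hM (n := n)
        · rw [res_add_natCast, res_natCast, hy, zero_add]
        · rw [res_add_natCast, hy, zero_add, Nat.mod_eq_of_lt hlt]
          exact Nat.succ_ne_zero _
      simp only [Bool.not_eq_true] at h
      have e : y + ((orbit M A p).1 : ℤ_[2]) + 1 = y + (((orbit M A p).1 + 1 : ℕ) : ℤ_[2]) := by
        push_cast; ring
      simp only [step, h, Bool.false_eq_true, if_false]
      rw [e]
      exact Prod.ext rfl (decide_eq_decide.2 this)

theorem spacerBit_mul (hM : StrictMono M) {n i : ℕ} (hi : 0 < i)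
    (hiq : i < 2 ^ (M (n + 1) - M n)) : spacerBit M A (i * 2 ^ M n) = (A n i).toNat := by
  have := mem_spacerSet_stage M A hM (y := ((i * 2 ^ M n : ℕ) : ℤ_[2])) hi hiq (by
    rw [res_natCast, Nat.mod_eq_of_lt]
    rw [← pow_mul_pow_sub M hM n]
    exact Nat.mul_lt_mul_of_pos_right hiq (by positivity))
  rw [spacerBit]
  cases h : A n i <;> simp only [h] at this <;> simp only [this] <;> simp

theorem spacerBit_add_mul (hM : StrictMono M) {n i r : ℕ} (hr : 0 < r) (hrQ : r < 2 ^ M n) :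
    spacerBit M A (i * 2 ^ M n + r) = spacerBit M A r := by
  have := mem_spacerSet_congr M A hM (n := n) (y := ((i * 2 ^ M n + r : ℕ) : ℤ_[2]))
    (z := (r : ℤ_[2])) (by rw [res_natCast, res_natCast, Nat.mul_add_mod_self_right])
    (by rw [res_natCast, Nat.mul_add_mod_self_right, Nat.mod_eq_of_lt hrQ]; exact hr.ne')
  rw [spacerBit, spacerBit]
  by_cases h : (r : ℤ_[2]) ∈ spacerSet M A
  · rw [if_pos h, if_pos (this.2 h)]
  · rw [if_neg h, if_neg (mt this.1 h)]

/-- Each column repeats the internal spacers of the `n`-th tower. Stopping at the top of column `i -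
1` counts the stage-`n` spacers below columns `1` to `i - 1` but not the one below column `i`. -/
theorem pos_mul_sub_one (hM : StrictMono M) (n i : ℕ) (hi : 1 ≤ i)
    (hiq : i ≤ 2 ^ (M (n + 1) - M n)) : pos M A (i * 2 ^ M n - 1) + 1 =
      i * height M A n + ∑ j ∈ Finset.Ico 1 i, (A n j).toNat := by
  have hQ : 0 < 2 ^ M n := by positivity
  induction i, hi using Nat.le_induction with
  | base => simp [height]
  | succ i hi ih =>
    have hiQ : 1 ≤ i * 2 ^ M n := Nat.mul_pos hi hQ
    have e : (i + 1) * 2 ^ M n - 1 = (i * 2 ^ M n - 1) + ((2 ^ M n - 1) + 1) := by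
      rw [add_mul]; omega
    rw [e, pos_add, Finset.sum_range_succ', Finset.sum_Ico_succ_top hi]
    have e1 : ∀ s ∈ Finset.range (2 ^ M n - 1),
        spacerBit M A (i * 2 ^ M n - 1 + (s + 1) + 1) = spacerBit M A (s + 1) := by
      intro s hs
      rw [Finset.mem_range] at hs
      rw [show i * 2 ^ M n - 1 + (s + 1) + 1 = i * 2 ^ M n + (s + 1) by omega]
      exact spacerBit_add_mul M A hM (Nat.succ_pos _) (by omega)
    rw [Finset.sum_congr rfl e1, show i * 2 ^ M n - 1 + 0 + 1 = i * 2 ^ M n by omega,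
      spacerBit_mul M A hM hi (by omega)]
    have := ih (by omega)
    have h2 : pos M A (2 ^ M n - 1) =
      (2 ^ M n - 1) + ∑ s ∈ Finset.range (2 ^ M n - 1), spacerBit M A (s + 1) := rfl
    rw [add_mul]
    unfold height at this ⊢
    omega

theorem height_succ (hM : StrictMono M) (n : ℕ) : height M A (n + 1) =
    2 ^ (M (n + 1) - M n) * height M A n +
      ∑ j ∈ Finset.Ico 1 (2 ^ (M (n + 1) - M n)), (A n j).toNat := by
  rw [← pos_mul_sub_one M A hM n _ Nat.one_le_two_pow le_rfl, pow_mul_pow_sub M hM]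
  rfl

theorem height_eq_towerHeight (hM0 : M 0 = 0) (hM : StrictMono M) (n : ℕ) :
    height M A n = towerHeight (fun n => 2 ^ (M (n + 1) - M n)) (fun n i => (A n i).toNat) n := by
  induction n with
  | zero => simp [height, hM0, pos, towerHeight]
  | succ n ih => rw [height_succ M A hM, ih]; rfl

theorem pow_le_height (n : ℕ) : 2 ^ M n ≤ height M A n := by
  have h := (pos_strictMono M A).le_apply (x := 2 ^ M n - 1)
  unfold height
  omega

end Orbit

/-! ### The tower map is rank one. -/

section RankOne

variable (M : ℕ → ℕ) (A : ℕ → ℕ → Bool)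

theorem res_sub_natCast {m r s : ℕ} {y : ℤ_[2]} (h : res m y = r + s) : res m (y - r) = s := by
  have h1 := res_add_natCast m r (y - r)
  rw [sub_add_cancel, h] at h1
  have h2 := res_lt m y
  have h3 := res_lt m (y - r)
  rcases Nat.lt_or_ge (res m (y - r) + r) (2 ^ m) with h4 | h4
  · rw [Nat.mod_eq_of_lt h4] at h1; omega
  · rw [Nat.mod_eq_sub_mod h4, Nat.mod_eq_of_lt (by omega)] at h1; omega

/-- The points with second coordinate `b` whose first coordinate has residue `r` modulo `2 ^ m`. -/
def cell (m r : ℕ) (b : Bool) : Set (ℤ_[2] × Bool) := {x | res m x.1 = r ∧ x.2 = b}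

theorem measurableSet_cell (m r : ℕ) (b : Bool) : MeasurableSet (cell m r b) :=
  (measurable_fst (measurableSet_res_eq m r)).inter (measurable_snd (measurableSet_singleton b))

theorem orbit_pos_sub_one {r : ℕ} (hr : 0 < r) (hE : (r : ℤ_[2]) ∈ spacerSet M A) :
    orbit M A (pos M A r - 1) = (r, true) := by
  obtain ⟨r, rfl⟩ : ∃ k, r = k + 1 := ⟨r - 1, by omega⟩
  have : pos M A (r + 1) - 1 = pos M A r + 1 := by rw [pos_succ, spacerBit, if_pos hE]; rfl
  rw [this, orbit, orbit_pos]
  simp at hE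
  simp [hE]

theorem image_cell {n k : ℕ} (hM : StrictMono M) (hk : k < height M A n) :
    (step M A)^[k] '' cell (M n) 0 false = cell (M n) (orbit M A k).1 (orbit M A k).2 := by
  have hlt := orbit_fst_lt M A hk
  ext ⟨y, b⟩
  constructor
  · rintro ⟨⟨z, c⟩, ⟨hz, hc⟩, h⟩
    simp only at hz hc
    subst hc
    rw [iterate_step M A hM hk hz, Prod.mk.injEq] at h
    refine ⟨?_, h.2.symm⟩
    simp only
    rw [← h.1, res_add_natCast, hz, zero_add, Nat.mod_eq_of_lt hlt]
  · rintro ⟨h1, h2⟩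
    simp only at h1 h2
    have hz := res_sub_natCast (s := 0) (h1.trans (add_zero _).symm)
    refine ⟨(y - (orbit M A k).1, false), ⟨hz, rfl⟩, ?_⟩
    rw [iterate_step M A hM hk hz, h2, sub_add_cancel]

open Classical in
theorem iterate_height (hM : StrictMono M) {n : ℕ} {y : ℤ_[2]} (hy : res (M n) y = 0) :
    (step M A)^[height M A n] (y, false) =
      (y + (2 ^ M n : ℕ), decide (y + (2 ^ M n : ℕ) ∈ spacerSet M A)) := by
  have hQ : 0 < 2 ^ M n := by positivity
  have e : y + ((2 ^ M n - 1 : ℕ) : ℤ_[2]) + 1 = y + ((2 ^ M n : ℕ) : ℤ_[2]) := by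
    rw [add_assoc, ← Nat.cast_add_one, Nat.sub_add_cancel hQ]
  rw [height, Function.iterate_succ_apply', iterate_step M A hM (n := n) (by simp [height]) hy,
    orbit_pos]
  simp only [step, Bool.false_eq_true, if_false]
  rw [e]

theorem isCutAndStack (hM0 : M 0 = 0) (hM : StrictMono M) :
    IsCutAndStack (towerMeasure M A) (stepEquiv M A) (fun n => 2 ^ (M (n + 1) - M n))
      (fun n i => (A n i).toNat) (fun n => cell (M n) 0 false)
      (fun n i => cell (M (n + 1)) ((i - 1) * 2 ^ M n) false)
      (fun n i _ => cell (M (n + 1)) (i * 2 ^ M n) true) where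
  two_le_q n := by
    calc 2 = 2 ^ 1 := rfl
      _ ≤ _ := Nat.pow_le_pow_right two_pos (Nat.sub_pos_of_lt (hM n.lt_succ_self))
  summable_spacers := by
    refine Summable.of_nonneg_of_le (fun n => by positivity) (fun n => ?_)
      (summable_geometric_two)
    -- There is at most one spacer per column, while columns have height at least `2 ^ M n`; the
    -- ratio is therefore at most `2 ^ (-n)`.
    have h1 : spacerCount (fun n => 2 ^ (M (n + 1) - M n)) (fun n i => (A n i).toNat) n ≤
        2 ^ (M (n + 1) - M n) := by
      refine (Finset.sum_le_card_nsmul _ _ 1 fun i _ => Bool.toNat_le _).trans ?_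
      simp
    have h2 := pow_le_height M A (n + 1)
    rw [height_eq_towerHeight M A hM0 hM, ← pow_mul_pow_sub M hM] at h2
    have h3 : 2 ^ n ≤ 2 ^ M n := Nat.pow_le_pow_right two_pos (hM.le_apply)
    rw [one_div, inv_pow, ← one_div]
    rw [div_le_div_iff₀ (by exact_mod_cast (by positivity : 0 < _).trans_le h2) (by positivity)]
    rw [one_mul]
    exact_mod_cast (Nat.mul_le_mul h1 h3).trans h2
  measurable_base n := measurableSet_cell _ _ _
  measurable_slice n i _ _ := measurableSet_cell _ _ _
  measurable_spacer n i j _ _ _ _ := measurableSet_cell _ _ _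
  disjoint_levels n k l hk hl hkl := by
    rw [← height_eq_towerHeight M A hM0 hM] at hk hl
    change Disjoint ((step M A)^[k] '' _) ((step M A)^[l] '' _)
    rw [image_cell M A hM hk, image_cell M A hM hl]
    refine Set.disjoint_left.2 fun x h1 h2 => hkl (orbit_injective M A ?_)
    exact Prod.ext (h1.1.symm.trans h2.1) (h1.2.symm.trans h2.2)
  slices_cover n := by
    ext x
    simp only [Set.mem_iUnion, Finset.mem_Icc, cell, Set.mem_ofPred_eq, exists_prop]
    have hle : M n ≤ M (n + 1) := hM.monotone n.le_succ
    have hQ : 0 < 2 ^ M n := by positivity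
    constructor
    · rintro ⟨i, _, h1, h2⟩
      refine ⟨?_, h2⟩
      rw [← res_mod hle, h1, Nat.mul_mod_left]
    · rintro ⟨h1, h2⟩
      rw [← res_mod hle] at h1
      obtain ⟨c, hc⟩ := Nat.dvd_of_mod_eq_zero h1
      have hlt := res_lt (M (n + 1)) x.1
      rw [hc, ← pow_mul_pow_sub M hM, mul_comm] at hlt
      refine ⟨c + 1, ⟨by omega, Nat.lt_of_mul_lt_mul_right hlt⟩, ?_, h2⟩
      rw [hc, mul_comm, Nat.add_sub_cancel]
  slices_disjoint n i j hi _ hj _ hij := by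
    refine Set.disjoint_left.2 fun x h1 h2 => hij ?_
    have := Nat.eq_of_mul_eq_mul_right (by positivity) (h1.1.symm.trans h2.1)
    omega
  glue_slice n i hi hiq := by
    rw [← height_eq_towerHeight M A hM0 hM]
    change (step M A)^[_] '' _ = _
    have hle : M n ≤ M (n + 1) := hM.monotone n.le_succ
    have hlt : i * 2 ^ M n < 2 ^ M (n + 1) := by
      rw [← pow_mul_pow_sub M hM]
      exact Nat.mul_lt_mul_of_pos_right hiq (by positivity)
    have hii : (i - 1) * 2 ^ M n + 2 ^ M n = i * 2 ^ M n := by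
      rw [← Nat.succ_mul, Nat.succ_eq_add_one, Nat.sub_add_cancel hi]
    have key : (step M A)^[height M A n] '' cell (M (n + 1)) ((i - 1) * 2 ^ M n) false =
        cell (M (n + 1)) (i * 2 ^ M n) (A n i) := by
      have h0 : ∀ z, res (M (n + 1)) z = (i - 1) * 2 ^ M n → (step M A)^[height M A n] (z, false) =
          (z + (2 ^ M n : ℕ), A n i) ∧
          res (M (n + 1)) (z + (2 ^ M n : ℕ)) = i * 2 ^ M n := by
        intro z hz
        have h1 : res (M n) z = 0 := by rw [← res_mod hle, hz, Nat.mul_mod_left]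
        have h2 : res (M (n + 1)) (z + (2 ^ M n : ℕ)) = i * 2 ^ M n := by
          rw [res_add_natCast, hz, hii, Nat.mod_eq_of_lt hlt]
        have h3 := mem_spacerSet_stage M A hM hi hiq h2
        refine ⟨?_, h2⟩
        rw [iterate_height M A hM h1]
        simp only [h3, Bool.decide_eq_true]
      ext ⟨y, b⟩
      constructor
      · rintro ⟨⟨z, c⟩, ⟨hz, hc⟩, h⟩
        simp only at hz hc
        subst hc
        obtain ⟨h1, h2⟩ := h0 z hz
        rw [h1, Prod.mk.injEq] at h
        exact ⟨h.1 ▸ h2, h.2.symm⟩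
      · rintro ⟨h1, h2⟩
        simp only at h1 h2
        have hz : res (M (n + 1)) (y - (2 ^ M n : ℕ)) = (i - 1) * 2 ^ M n :=
          res_sub_natCast (by omega)
        refine ⟨(y - (2 ^ M n : ℕ), false), ⟨hz, rfl⟩, ?_⟩
        rw [(h0 _ hz).1, h2, sub_add_cancel]
    rw [key]
    cases A n i <;> simp
  glue_spacer n i j hi hiq hj hji := by
    change step M A '' _ = _
    have hj1 : j = 1 := le_antisymm (hji.trans (Bool.toNat_le _)) hj
    subst hj1
    have hA : A n i = true := by cases h : A n i <;> simp_all
    simp only [hA, Bool.toNat_true, lt_irrefl, if_false, Nat.add_sub_cancel]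
    have h0 : ∀ z, res (M (n + 1)) z = i * 2 ^ M n → step M A (z, true) = (z, false) := by
      intro z hz
      have := (mem_spacerSet_stage M A hM hi hiq hz).2 hA
      simp [step, this]
    ext ⟨y, b⟩
    constructor
    · rintro ⟨⟨z, c⟩, ⟨hz, hc⟩, h⟩
      simp only at hz hc
      subst hc
      rw [h0 z hz, Prod.mk.injEq] at h
      exact ⟨h.1 ▸ hz, h.2.symm⟩
    · rintro ⟨h1, h2⟩
      simp only at h1 h2
      exact ⟨(y, true), ⟨h1, rfl⟩, by rw [h0 y h1, h2]⟩
  base_succ n := by simp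
  generating B hB ε hε := by
    classical
    have hE := measurableSet_spacerSet M A
    have hB1 : MeasurableSet {y | (y, false) ∈ B} := measurable_prodMk_right hB
    have hB2 : MeasurableSet {y | (y, true) ∈ B} := measurable_prodMk_right hB
    obtain ⟨m₁, hm₁⟩ := exists_finset_symmDiff_lt _ hB1 (ε / 3) (by linarith)
    obtain ⟨m₂, hm₂⟩ := exists_finset_symmDiff_lt _ hB2 (ε / 3) (by linarith)
    obtain ⟨m₃, hm₃⟩ := exists_pow_lt_of_lt_one (show 0 < ε / 3 by linarith)
      (by norm_num : (1 / 2 : ℝ) < 1)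
    filter_upwards [eventually_ge_atTop (m₁ + m₂ + m₃)] with n hn
    have hnM : n ≤ M n := hM.le_apply
    obtain ⟨R₁, hR₁⟩ := hm₁ (M n) (by omega)
    obtain ⟨R₂, hR₂⟩ := hm₂ (M n) (by omega)
    rw [← height_eq_towerHeight M A hM0 hM]
    -- Base levels and spacer levels are selected separately, from residue approximations of the two
    -- slices of `B`.
    set s := (Finset.range (height M A n)).filter
      (fun k => if (orbit M A k).2 = true then (orbit M A k).1 ∈ R₂ else (orbit M A k).1 ∈ R₁)
      with hs
    refine ⟨s, Finset.filter_subset _ _, ?_⟩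
    have hU : (⋃ k ∈ s, (⇑(stepEquiv M A))^[k] '' cell (M n) 0 false) =
        ⋃ k ∈ s, cell (M n) (orbit M A k).1 (orbit M A k).2 := by
      refine Set.iUnion₂_congr fun k hk => ?_
      exact image_cell M A hM (Finset.mem_range.1 (Finset.mem_filter.1 hk).1)
    rw [hU]
    set U := ⋃ k ∈ s, cell (M n) (orbit M A k).1 (orbit M A k).2 with hUdef
    have hUm : MeasurableSet U := Finset.measurableSet_biUnion _ fun k _ => measurableSet_cell _ _ _
    have hmem : ∀ y b, (y, b) ∈ U ↔ ∃ k ∈ s, orbit M A k = (res (M n) y, b) := by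
      intro y b
      simp only [hUdef, Set.mem_iUnion, exists_prop, cell, Set.mem_ofPred_eq, Prod.ext_iff, eq_comm]
    have hpos : ∀ y, pos M A (res (M n) y) < height M A n := by
      intro y
      have h1 := res_lt (M n) y
      have := (pos_strictMono M A).monotone (show res (M n) y ≤ 2 ^ M n - 1 by omega)
      unfold height; omega
    have hf : {y | (y, false) ∈ symmDiff B U} =
        symmDiff {y | (y, false) ∈ B} {y | res (M n) y ∈ R₁} := by
      have : ∀ y, (y, false) ∈ U ↔ res (M n) y ∈ R₁ := by
        intro y
        rw [hmem]
        constructor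
        · rintro ⟨k, hk, hk'⟩
          have := (Finset.mem_filter.1 hk).2
          simpa [hk'] using this
        · intro h
          refine ⟨pos M A (res (M n) y), ?_, orbit_pos _ _ _⟩
          rw [hs, Finset.mem_filter, Finset.mem_range, orbit_pos]
          exact ⟨hpos y, by simpa using h⟩
      ext y
      simp only [Set.mem_ofPred_eq, Set.mem_symmDiff, this]
    -- Spacers over the class of zero come from stages `n` and later and lie outside the `n`-th
    -- tower; they are absorbed by the measure of that class.
    have ht : {y | (y, true) ∈ symmDiff B U} ∩ spacerSet M A ⊆
        symmDiff {y | (y, true) ∈ B} {y | res (M n) y ∈ R₂} ∪ {y | res (M n) y = 0} := by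
      have : ∀ y ∈ spacerSet M A, res (M n) y ≠ 0 → ((y, true) ∈ U ↔ res (M n) y ∈ R₂) := by
        intro y hy hy0
        rw [hmem]
        constructor
        · rintro ⟨k, hk, hk'⟩
          have := (Finset.mem_filter.1 hk).2
          simpa [hk'] using this
        · intro h
          have hyE : ((res (M n) y : ℕ) : ℤ_[2]) ∈ spacerSet M A := by
            refine (mem_spacerSet_congr M A hM (n := n) ?_ hy0).1 hy
            rw [res_natCast, Nat.mod_eq_of_lt (res_lt _ _)]
          have horb := orbit_pos_sub_one M A (Nat.pos_of_ne_zero hy0) hyE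
          refine ⟨pos M A (res (M n) y) - 1, ?_, horb⟩
          rw [hs, Finset.mem_filter, Finset.mem_range, horb]
          exact ⟨(Nat.sub_le _ _).trans_lt (hpos y), by simpa using h⟩
      rintro y ⟨h1, h2⟩
      by_cases hy0 : res (M n) y = 0
      · exact Or.inr hy0
      · left
        simp only [Set.mem_ofPred_eq, Set.mem_symmDiff, this y h2 hy0] at h1 ⊢
        exact h1
    have h0 : haar.real {y | res (M n) y = 0} < ε / 3 := by
      rw [haar_res_eq _ _ (by positivity)]
      refine lt_of_le_of_lt ?_ hm₃
      rw [one_div_pow]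
      exact one_div_le_one_div_of_le (by positivity)
        (pow_le_pow_right₀ one_le_two (by omega))
    have h2 : haar.real ({y | (y, true) ∈ symmDiff B U} ∩ spacerSet M A) < ε / 3 + ε / 3 :=
      ((measureReal_mono ht).trans (measureReal_union_le _ _)).trans_lt (by linarith)
    rw [towerMeasure_real M A (hB.symmDiff hUm), hf]
    have hmass : (mass M A)⁻¹ ≤ 1 := inv_le_one_of_one_le₀ (one_le_mass M A)
    have hnn : 0 ≤ haar.real (symmDiff {y | (y, false) ∈ B} {y | res (M n) y ∈ R₁}) +
        haar.real ({y | (y, true) ∈ symmDiff B U} ∩ spacerSet M A) := by positivity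
    calc _ ≤ 1 * _ := mul_le_mul_of_nonneg_right hmass hnn
      _ < ε := by linarith

theorem isRankOneSystem (hM0 : M 0 = 0) (hM : StrictMono M) :
    IsRankOneSystem (towerMeasure M A) (stepEquiv M A) (height M A) :=
  ⟨inferInstance, measurePreserving_step M A, _, _, _, _, _, isCutAndStack M A hM0 hM,
    funext (height_eq_towerHeight M A hM0 hM)⟩

end RankOne

end TwoAdicTower

/-! ### Lower bounds for Shannon entropy. -/

section Entropy

/-- Concavity of entropy: a probability vector which dominates a sub-convex combination of
probability vectors has at least the corresponding combination of their entropies. -/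
theorem sum_mul_sum_negMulLog_le {J κ : Type*} [Fintype J] [Fintype κ] (p : J → ℝ)
    (c : J → κ → ℝ) (x : κ → ℝ) (hp : ∀ j, 0 ≤ p j) (hc : ∀ j w, 0 ≤ c j w)
    (hc1 : ∀ j, ∑ w, c j w = 1) (hx : ∀ w, ∑ j, p j * c j w ≤ x w) (hx1 : ∑ w, x w = 1) :
    ∑ j, p j * ∑ w, Real.negMulLog (c j w) ≤ ∑ w, Real.negMulLog (x w) := by
  set p₀ : ℝ := 1 - ∑ j, p j with hp₀
  -- The defect is treated as one more component of weight `p₀`. Jensen's inequality then applies to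
  -- `Option J`, and the extra term is nonnegative.
  set x₀ : κ → ℝ := fun w => x w - ∑ j, p j * c j w with hx₀
  have hx₀nn : ∀ w, 0 ≤ x₀ w := fun w => sub_nonneg.2 (hx w)
  have hsum : ∑ w, x₀ w = p₀ := by
    simp only [hx₀, Finset.sum_sub_distrib, hx1]
    rw [Finset.sum_comm]
    simp only [← Finset.mul_sum, hc1, mul_one, hp₀]
  have hp₀nn : 0 ≤ p₀ := hsum ▸ Finset.sum_nonneg fun w _ => hx₀nn w
  have hx₀le : ∀ w, x₀ w ≤ p₀ := fun w =>
    hsum ▸ Finset.single_le_sum (fun w _ => hx₀nn w) (Finset.mem_univ w)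
  have hmul : ∀ w, p₀ * (x₀ w / p₀) = x₀ w := by
    intro w
    rcases hp₀nn.eq_or_lt with h | h
    · have := hx₀le w
      rw [← h] at this ⊢
      linarith [hx₀nn w]
    · field_simp
  have key : ∀ w, ∑ j, p j * Real.negMulLog (c j w) ≤ Real.negMulLog (x w) := by
    intro w
    have := Real.concaveOn_negMulLog.le_map_sum (t := (Finset.univ : Finset (Option J)))
      (w := fun o => o.elim p₀ p) (p := fun o => o.elim (x₀ w / p₀) (fun j => c j w))
      (by rintro (_ | j) _; exacts [hp₀nn, hp j])
      (by simp [Fintype.sum_option, hp₀])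
      (by rintro (_ | j) _; exacts [div_nonneg (hx₀nn w) hp₀nn, hc j w])
    simp only [Fintype.sum_option, Option.elim, smul_eq_mul, hmul] at this
    have h1 : x₀ w + ∑ j, p j * c j w = x w := by simp [hx₀]
    rw [h1] at this
    have h2 : 0 ≤ p₀ * Real.negMulLog (x₀ w / p₀) :=
      mul_nonneg hp₀nn (Real.negMulLog_nonneg (div_nonneg (hx₀nn w) hp₀nn)
        (div_le_one_of_le₀ (hx₀le w) hp₀nn))
    linarith
  calc _ = ∑ w, ∑ j, p j * Real.negMulLog (c j w) := by
        simp only [Finset.mul_sum]; rw [Finset.sum_comm]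
    _ ≤ _ := Finset.sum_le_sum fun w _ => key w

/-- Every atom of positive mass has information at least `D * log 2`; entropy is the mean
information. -/
theorem mul_log_two_le_sum_negMulLog {κ : Type*} [Fintype κ] (c : κ → ℝ) (D : ℕ)
    (hc : ∀ w, 0 ≤ c w) (hc1 : ∑ w, c w = 1) (hD : ∀ w, c w * 2 ^ D ≤ 1) :
    D * Real.log 2 ≤ ∑ w, Real.negMulLog (c w) := by
  calc D * Real.log 2 = ∑ w, c w * (D * Real.log 2) := by rw [← Finset.sum_mul, hc1, one_mul]
    _ ≤ _ := Finset.sum_le_sum fun w _ => ?_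
  rcases (hc w).eq_or_lt with h | h
  · simp [← h]
  · have h1 : Real.log (c w * 2 ^ D) ≤ 0 := Real.log_nonpos (by positivity) (hD w)
    rw [Real.log_mul h.ne' (by positivity), Real.log_pow] at h1
    rw [Real.negMulLog]
    nlinarith

/-- Entropy lower bound: if the coding map is constant on the members of a disjoint family of sets
of equal measure, and each group of the family is split into small parts by the coding map, then
the coding map has large entropy. -/
theorem sum_mul_log_two_le_partitionEntropy {X κ J B : Type*} [MeasurableSpace X] [Fintype κ]
    [DecidableEq κ] [MeasurableSpace κ] [MeasurableSingletonClass κ]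
    [Fintype J] [Fintype B] [Nonempty B] (μ : Measure X) [IsProbabilityMeasure μ] (φ : X → κ)
    (hφ : Measurable φ) (L : J × B → Set X) (hL : ∀ i, MeasurableSet (L i))
    (hdisj : Pairwise (Function.onFun Disjoint L)) (m : ℝ) (hm : ∀ i, μ.real (L i) = m)
    (wd : J → B → κ) (hwd : ∀ j b, ∀ x ∈ L (j, b), φ x = wd j b) (D : J → ℕ)
    (hD : ∀ j w, (Finset.univ.filter fun b => wd j b = w).card * 2 ^ D j ≤ Fintype.card B) :
    m * Fintype.card B * Real.log 2 * ∑ j, (D j : ℝ) ≤ partitionEntropy μ φ := by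
  classical
  have hB : (0 : ℝ) < Fintype.card B := by exact_mod_cast Fintype.card_pos
  set c : J → κ → ℝ := fun j w =>
    ((Finset.univ.filter fun b => wd j b = w).card : ℝ) / Fintype.card B with hc
  have hc0 : ∀ j w, 0 ≤ c j w := fun j w => by positivity
  have hc1 : ∀ j, ∑ w, c j w = 1 := by
    intro j
    simp only [hc]
    rw [← Finset.sum_div, ← Nat.cast_sum, ← Finset.card_eq_sum_card_fiberwise (by simp)]
    simp [hB.ne']
  rcases isEmpty_or_nonempty J with hJ | ⟨⟨j₀⟩⟩
  · simp only [Finset.univ_eq_empty, Finset.sum_empty, mul_zero]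
    exact Finset.sum_nonneg fun w _ => Real.negMulLog_nonneg measureReal_nonneg measureReal_le_one
  have hm0 : 0 ≤ m := hm (j₀, Classical.arbitrary B) ▸ measureReal_nonneg
  have hx1 : ∑ w, μ.real (φ ⁻¹' {w}) = 1 := by
    rw [← measureReal_biUnion_finset]
    · have : (⋃ w ∈ (Finset.univ : Finset κ), φ ⁻¹' {w}) = Set.univ := by ext; simp
      rw [this]; simp
    · intro w _ w' _ hww
      exact Set.disjoint_left.2 fun x h1 h2 => hww (h1.symm.trans h2)
    · exact fun w _ => hφ (measurableSet_singleton w)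
  have hx : ∀ w, ∑ j, m * Fintype.card B * c j w ≤ μ.real (φ ⁻¹' {w}) := by
    intro w
    have h1 : ∑ j, m * Fintype.card B * c j w =
        ∑ i ∈ (Finset.univ : Finset (J × B)).filter (fun i => wd i.1 i.2 = w), μ.real (L i) := by
      simp only [hm, Finset.sum_filter]
      rw [Fintype.sum_prod_type]
      refine Finset.sum_congr rfl fun j _ => ?_
      rw [← Finset.sum_filter, Finset.sum_const, nsmul_eq_mul]
      simp only [hc]
      field_simp
    rw [h1, ← measureReal_biUnion_finset (fun i _ i' _ h => hdisj h) (fun i _ => hL i)]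
    refine measureReal_mono ?_
    refine Set.iUnion₂_subset fun i hi x hx => ?_
    exact (hwd i.1 i.2 x hx).trans (Finset.mem_filter.1 hi).2
  refine le_trans ?_ (sum_mul_sum_negMulLog_le (fun _ => m * Fintype.card B) c _
    (fun _ => by positivity) hc0 hc1 hx hx1)
  rw [Finset.mul_sum]
  refine Finset.sum_le_sum fun j _ => ?_
  rw [mul_assoc, mul_comm (Real.log 2)]
  refine mul_le_mul_of_nonneg_left (mul_log_two_le_sum_negMulLog _ _ (hc0 j) (hc1 j) fun w => ?_)
    (by positivity)
  simp only [hc]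
  rw [div_mul_eq_mul_div, div_le_one hB]
  exact_mod_cast hD j w

end Entropy

/-! ### Counting binary words and good residues. -/

section Counting

/-- Words that agree on `I` are determined by their bits at the other `W - I.card` places. -/
theorem card_mul_two_pow_le_of_testBit_eq {W : ℕ} (I : Finset ℕ) (hI : I ⊆ Finset.range W)
    (S : Finset (Fin (2 ^ W)))
    (hS : ∀ b ∈ S, ∀ b' ∈ S, ∀ i ∈ I, (b : ℕ).testBit i = (b' : ℕ).testBit i) :
    S.card * 2 ^ I.card ≤ 2 ^ W := by
  have h1 : S.card ≤ ((Finset.range W \ I).powerset).card := by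
    refine Finset.card_le_card_of_injOn
      (fun b => (Finset.range W \ I).filter fun i => (b : ℕ).testBit i = true)
      (fun b _ => Finset.mem_coe.2 (Finset.mem_powerset.2 (Finset.filter_subset _ _))) ?_
    intro b hb b' hb' h
    refine Fin.ext (Nat.eq_of_testBit_eq fun i => ?_)
    by_cases hiI : i ∈ I
    · exact hS b hb b' hb' i hiI
    · rcases Nat.lt_or_ge i W with hi | hi
      · have := Finset.ext_iff.1 h i
        simp only [Finset.mem_filter, Finset.mem_sdiff, Finset.mem_range, hi, hiI, not_false_iff,
          and_self, true_and] at this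
        exact Bool.eq_iff_iff.2 this
      · rw [Nat.testBit_lt_two_pow (b.2.trans_le (Nat.pow_le_pow_right two_pos hi)),
          Nat.testBit_lt_two_pow (b'.2.trans_le (Nat.pow_le_pow_right two_pos hi))]
  rw [Finset.card_powerset, Finset.card_sdiff_of_subset hI, Finset.card_range] at h1
  have h2 : I.card ≤ W := by simpa using Finset.card_le_card hI
  calc _ ≤ 2 ^ (W - I.card) * 2 ^ I.card := Nat.mul_le_mul_right _ h1
    _ = 2 ^ W := by rw [← pow_add, Nat.sub_add_cancel h2]

/-- Translation by `t` permutes the residues modulo `P`; the proof uses the inverse translation. -/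
theorem pred_le_card_filter_add_mod {P h : ℕ} (hP : h ≤ P) (t : ℕ) :
    h - 1 ≤ ((Finset.univ : Finset (Fin P)).filter
      fun u : Fin P => 1 ≤ ((u : ℕ) + t) % P ∧ ((u : ℕ) + t) % P < h).card := by
  rcases Nat.eq_zero_or_pos P with rfl | hPpos
  · omega
  have key : ∀ v < P, ((v + (P - t % P)) % P + t) % P = v := by
    intro v hv
    have h1 : t % P < P := Nat.mod_lt _ hPpos
    rw [Nat.mod_add_mod]
    have h2 := Nat.div_add_mod t P
    have : v + (P - t % P) + t = v + P * (t / P + 1) := by rw [mul_add]; omega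
    rw [this, Nat.add_mul_mod_self_left, Nat.mod_eq_of_lt hv]
  rw [← Nat.card_Ico 1 h]
  refine Finset.card_le_card_of_injOn
    (fun v => (⟨(v + (P - t % P)) % P, Nat.mod_lt _ hPpos⟩ : Fin P)) ?_ ?_
  · intro v hv
    have hv' := Finset.mem_Ico.1 hv
    simp only [Finset.coe_filter, Finset.mem_univ, true_and, Set.mem_ofPred_eq]
    rw [key v (by omega)]
    exact hv'
  · intro v hv v' hv' h
    have h1 := Finset.mem_Ico.1 hv
    have h2 := Finset.mem_Ico.1 hv'
    have h3 : (v + (P - t % P)) % P = (v' + (P - t % P)) % P := congrArg Fin.val h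
    rw [← key v (by omega), ← key v' (by omega), h3]

end Counting

namespace TwoAdicTower

/-! ### The spacer pattern that spells all binary words. -/

section Pattern

/-- The `l`-th bit of the concatenation of the binary words of length `W`, where the first bit of
each word is erased. -/
def wordBit (W l : ℕ) : Bool := decide (l % W ≠ 0) && (l / W).testBit (l % W)

/-- Spacer pattern: the superblock of columns `2 * l` and `2 * l + 1` has exactly one spacer, below
one or the other column according to `wordBit W l`. -/
def spacerPattern (W i : ℕ) : Bool := if i % 2 = 0 then wordBit W (i / 2) else !wordBit W (i / 2)

theorem spacerPattern_two_mul (W l : ℕ) : spacerPattern W (2 * l) = wordBit W l := by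
  simp [spacerPattern]

theorem spacerPattern_two_mul_add_one (W l : ℕ) :
    spacerPattern W (2 * l + 1) = !wordBit W l := by
  have h1 : (2 * l + 1) % 2 = 1 := by omega
  have h2 : (2 * l + 1) / 2 = l := by omega
  simp [spacerPattern, h1, h2]

theorem wordBit_block {W b i : ℕ} (hi : 0 < i) (hiW : i < W) :
    wordBit W (b * W + i) = b.testBit i := by
  have h1 : (b * W + i) % W = i := by rw [Nat.mul_add_mod_self_right, Nat.mod_eq_of_lt hiW]
  have h2 : (b * W + i) / W = b := by
    rw [mul_comm, Nat.mul_add_div (by omega), Nat.div_eq_of_lt hiW, add_zero]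
  simp [wordBit, h1, h2, hi.ne']

/-- Each pair of columns contributes one. Omitting column zero loses nothing, because `wordBit W 0`
is false and the first pair has its spacer below column one. -/
theorem sum_spacerPattern (W l : ℕ) (hl : 1 ≤ l) :
    ∑ j ∈ Finset.Ico 1 (2 * l), (spacerPattern W j).toNat = l := by
  induction l, hl using Nat.le_induction with
  | base =>
    have := spacerPattern_two_mul_add_one W 0
    simp only [mul_zero, zero_add] at this
    simp [wordBit, this]
  | succ l hl ih =>
    rw [show 2 * (l + 1) = 2 * l + 1 + 1 by ring, Finset.sum_Ico_succ_top (by omega),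
      Finset.sum_Ico_succ_top (by omega), ih, spacerPattern_two_mul,
      spacerPattern_two_mul_add_one]
    cases wordBit W l <;> simp

end Pattern

/-! ### Reading the pattern from the parity code. -/

section Coding

variable (M : ℕ → ℕ) (A : ℕ → ℕ → Bool)

/-- Coding map by the parity of the first coordinate and the second coordinate. -/
noncomputable def parityCode (x : ℤ_[2] × Bool) : Fin 4 :=
  ⟨2 * res 1 x.1 + x.2.toNat, by
    have h1 := res_lt 1 x.1
    have h2 := Bool.toNat_le x.2
    omega⟩

theorem measurable_parityCode : Measurable parityCode := by
  refine measurable_of_fibers fun b => ?_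
  have : (fun y => parityCode (y, b)) =
      (fun r : ℕ => (Fin.ofNat 4 (2 * r + b.toNat))) ∘ res 1 := by
    ext y
    have h1 := res_lt 1 y
    have h2 := Bool.toNat_le b
    simp only [parityCode, Function.comp_apply, Fin.val_ofNat]
    omega
  rw [this]
  exact (measurable_of_countable _).comp (measurable_res 1)

/-- Code of the `p`-th point of the orbit of `(0, false)`. -/
noncomputable def orbitCode (p : ℕ) : ℕ := 2 * ((orbit M A p).1 % 2) + (orbit M A p).2.toNat

theorem parityCode_iterate (hM : StrictMono M) {n p : ℕ} (hn : 1 ≤ M n) (hp : p < height M A n)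
    {y : ℤ_[2]} (hy : res (M n) y = 0) :
    (parityCode ((step M A)^[p] (y, false)) : ℕ) = orbitCode M A p := by
  rw [iterate_step M A hM hp hy, parityCode, orbitCode]
  simp only [res_add_natCast]
  rw [← res_mod hn, hy]
  simp

/-- A step from a base point changes the parity of the index; a step from a spacer keeps the index
but changes the Boolean. -/
theorem orbitCode_succ_ne (p : ℕ) : orbitCode M A (p + 1) ≠ orbitCode M A p := by
  unfold orbitCode
  rw [orbit]
  cases h : (orbit M A p).2
  · simp only [Bool.false_eq_true, if_false, Bool.toNat_false]
    have := Bool.toNat_le (open Classical in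
      decide ((((orbit M A p).1 + 1 : ℕ) : ℤ_[2]) ∈ spacerSet M A))
    omega
  · simp

variable {M A} {n W : ℕ}

theorem pos_superblock (hM : StrictMono M) (hA : A n = spacerPattern W)
    (hq : 2 ^ (M (n + 1) - M n) = 2 * (W * 2 ^ W)) {l : ℕ} (hl : 1 ≤ l) (hlW : l ≤ W * 2 ^ W) :
    pos M A (2 * l * 2 ^ M n - 1) + 1 = l * (2 * height M A n + 1) := by
  rw [pos_mul_sub_one M A hM n (2 * l) (by omega) (by rw [hq]; omega), hA,
    sum_spacerPattern W l hl]
  ring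

theorem height_superblock (hM : StrictMono M) (hA : A n = spacerPattern W) (hW : 1 ≤ W)
    (hq : 2 ^ (M (n + 1) - M n) = 2 * (W * 2 ^ W)) :
    height M A (n + 1) = W * 2 ^ W * (2 * height M A n + 1) := by
  have h1 : 1 ≤ W * 2 ^ W := Nat.mul_pos hW (by positivity)
  rw [← pos_superblock hM hA hq h1 le_rfl, height, ← pow_mul_pow_sub M hM, hq]

/-- Superblock `l` starts at time `l * (2 * height M A n + 1)`, with its spacer if the bit is set
and with the base of column `2 * l` otherwise. The bit thus delays the first column by one; the
bounds on `v` keep both possible levels inside that column. -/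
theorem orbitCode_superblock (hM : StrictMono M) (hn : 1 ≤ M n) (hA : A n = spacerPattern W)
    (hq : 2 ^ (M (n + 1) - M n) = 2 * (W * 2 ^ W)) {l v : ℕ} (hl : 1 ≤ l) (hlW : l < W * 2 ^ W)
    (hv : 1 ≤ v) (hvh : v < height M A n) :
    orbitCode M A (l * (2 * height M A n + 1) + v) =
      orbitCode M A (v - (wordBit W l).toNat) := by
  have hQ : 0 < 2 ^ M n := by positivity
  have hW : 1 ≤ W := by
    rcases Nat.eq_zero_or_pos W with rfl | h
    · simp at hlW
    · exact h
  have hlQ : 1 ≤ 2 * l * 2 ^ M n := Nat.mul_pos (by omega) hQ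
  have hbit := Bool.toNat_le (wordBit W l)
  set v' := v - (wordBit W l).toNat with hv'
  have hp : l * (2 * height M A n + 1) + v = v' + pos M A (2 * l * 2 ^ M n) := by
    have h1 := pos_superblock hM hA hq hl hlW.le
    have h2 := pos_succ M A (2 * l * 2 ^ M n - 1)
    rw [Nat.sub_add_cancel hlQ, spacerBit_mul M A hM (by omega) (by rw [hq]; omega), hA,
      spacerPattern_two_mul] at h2
    omega
  have hlt : l * (2 * height M A n + 1) + v < height M A (n + 1) := by
    rw [height_superblock hM hA hW hq]
    calc _ < (l + 1) * (2 * height M A n + 1) := by rw [add_mul]; omega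
      _ ≤ _ := Nat.mul_le_mul_right _ hlW
  have hn1 : 1 ≤ M (n + 1) := hn.trans (hM.monotone n.le_succ)
  rw [← parityCode_iterate M A hM hn1 hlt (res_zero _),
    ← parityCode_iterate M A hM hn (p := v') (y := ((2 * l * 2 ^ M n : ℕ) : ℤ_[2]))
      (by omega) (by rw [res_natCast, Nat.mul_mod_left]), hp, Function.iterate_add_apply,
    iterate_step M A hM (n := n + 1) (by omega) (res_zero _), orbit_pos, zero_add]

theorem measureReal_level {k : ℕ} :
    (towerMeasure M A).real ((step M A)^[k] '' cell (M n) 0 false) =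
      1 / (2 ^ M n * mass M A) := by
  have h1 : (towerMeasure M A).real (cell (M n) 0 false) = 1 / (2 ^ M n * mass M A) := by
    rw [towerMeasure_real M A (measurableSet_cell _ _ _)]
    have e1 : {y | (y, false) ∈ cell (M n) 0 false} = {y | res (M n) y = 0} := by
      ext; simp [cell]
    have e2 : {y | (y, true) ∈ cell (M n) 0 false} = ∅ := by
      ext; simp [cell]
    rw [e1, e2, haar_res_eq _ _ (by positivity)]
    simp
  rw [← h1]
  have hinj : Function.Injective (step M A)^[k] := (stepEquiv M A).injective.iterate k
  have hmp := (measurePreserving_step M A).iterate k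
  have hmeas : MeasurableSet ((step M A)^[k] '' cell (M n) 0 false) := by
    have e : (step M A)^[k] '' cell (M n) 0 false =
        (stepInv M A)^[k] ⁻¹' cell (M n) 0 false :=
      congrFun (Set.image_eq_preimage_of_inverse
        (Function.LeftInverse.iterate (stepInv_step M A) k)
        (Function.LeftInverse.iterate (step_stepInv M A) k)) _
    rw [e]
    exact ((measurable_stepInv M A).iterate k) (measurableSet_cell _ _ _)
  have := hmp.measureReal_preimage hmeas.nullMeasurableSet
  rw [← this]
  congr 1
  exact Set.preimage_image_eq _ hinj

end Coding

/-! ### Entropy estimate at a single stage. -/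

variable {M : ℕ → ℕ} {A : ℕ → ℕ → Bool} {n : ℕ}

/-- Sampling a sequence of times with gaps at least `P`, the quotients by `P` are distinct. -/
theorem strictMono_add_div {P u : ℕ} (hP : 0 < P) {s : ℕ → ℕ} (hs : ∀ j, s j + P ≤ s (j + 1)) :
    StrictMono fun j => (u + s j) / P := by
  refine strictMono_nat_of_lt_succ fun j => ?_
  calc (u + s j) / P < (u + s j) / P + 1 := Nat.lt_succ_self _
    _ = (u + s j + P) / P := (Nat.add_div_right _ hP).symm
    _ ≤ _ := Nat.div_le_div_right (by have := hs j; omega)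

/-- For a fixed starting position `(o, u)` the observed name determines the bits of the word `b` at
distinct places, one for each good sampling time. Each `b` is equally likely, and the number of good
times is summed over all positions. -/
theorem partitionEntropy_sequenceCoding_ge {V : ℕ} (hV : 2 ≤ V) (hM : StrictMono M)
    (hn : 1 ≤ M n) (hA : A n = spacerPattern (2 * V))
    (hq : 2 ^ (M (n + 1) - M n) = 2 * (2 * V * 2 ^ (2 * V)))
    {t : ℕ → ℕ} (ht : Monotone t) {K : ℕ} (hK : 1 ≤ K)
    (hgap : ∀ k ≥ K, t k + (2 * height M A n + 1) ≤ t (k + 4))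
    (hbound : t (5 * K) ≤ V * (2 * height M A n + 1)) :
    K * Real.log 2 / 32 ≤ partitionEntropy (towerMeasure M A)
      (sequenceCoding (stepEquiv M A) t parityCode (5 * K)) := by
  classical
  set h := height M A n with hh
  set P := 2 * h + 1 with hP
  set W := 2 * V with hW
  have hPpos : 0 < P := Nat.succ_pos _
  have hQh : 2 ^ M n ≤ h := pow_le_height M A n
  have hQ2 : 2 ≤ 2 ^ M n := by
    calc 2 = 2 ^ 1 := rfl
      _ ≤ _ := Nat.pow_le_pow_right two_pos hn
  have hn1 : 1 ≤ M (n + 1) := hn.trans (hM.monotone n.le_succ)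
  have hheight : height M A (n + 1) = W * 2 ^ W * P :=
    height_superblock hM hA (by omega) hq
  -- Level at offset `u` of superblock `o + 1` of word `b`. Starting at place `o + 1` avoids the
  -- erased first bit; `o < V - 1` leaves room for `V` further superblocks in the same word.
  set lev : (Fin (V - 1) × Fin P) × Fin (2 ^ W) → ℕ :=
    fun i => ((i.2 : ℕ) * W + (i.1.1 + 1)) * P + i.1.2 with hlev
  have hdivmod : ∀ a (u : Fin P), (a * P + u) / P = a ∧ (a * P + u) % P = u := by
    intro a u
    constructor
    · rw [mul_comm, Nat.mul_add_div hPpos, Nat.div_eq_of_lt u.2, add_zero]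
    · rw [Nat.mul_add_mod_self_right, Nat.mod_eq_of_lt u.2]
  have hlev_inj : Function.Injective lev := by
    rintro ⟨⟨o, u⟩, b⟩ ⟨⟨o', u'⟩, b'⟩ heq
    simp only [hlev] at heq
    have h1 : u = u' := Fin.ext (by
      rw [← (hdivmod ((b : ℕ) * W + (o + 1)) u).2, heq, (hdivmod _ u').2])
    have h2 : (b : ℕ) * W + (o + 1) = (b' : ℕ) * W + (o' + 1) := by
      rw [← (hdivmod ((b : ℕ) * W + (o + 1)) u).1, heq, (hdivmod _ u').1]
    have ho : (o : ℕ) + 1 < W := by have := o.2; omega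
    have ho' : (o' : ℕ) + 1 < W := by have := o'.2; omega
    have h3 : (o : ℕ) + 1 = o' + 1 := by
      rw [← Nat.mod_eq_of_lt ho, ← Nat.mod_eq_of_lt ho',
        ← Nat.mul_add_mod_self_right (b : ℕ) W (o + 1), h2, Nat.mul_add_mod_self_right]
    have h4 : (b : ℕ) = b' := Nat.eq_of_mul_eq_mul_right (show 0 < W by omega) (by omega)
    rw [h1, Fin.ext h4, Fin.ext (show (o : ℕ) = o' by omega)]
  have htle : ∀ k : Fin (5 * K), t (k + 1) ≤ V * P := fun k =>
    (ht (show (k : ℕ) + 1 ≤ 5 * K from k.2)).trans hbound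
  have hlt : ∀ i s, s ≤ V * P → lev i + s < height M A (n + 1) := by
    rintro ⟨⟨o, u⟩, b⟩ s hs
    rw [hheight]
    simp only [hlev]
    have ho := o.2
    have hu := u.2
    have hb : (b : ℕ) + 1 ≤ 2 ^ W := b.2
    calc ((b : ℕ) * W + (o + 1)) * P + u + s
        < ((b : ℕ) * W + (o + 1)) * P + P + V * P := by omega
      _ = ((b : ℕ) * W + (o + 2 + V)) * P := by ring
      _ ≤ (((b : ℕ) + 1) * W) * P := Nat.mul_le_mul_right _ (by rw [add_mul]; omega)
      _ ≤ (2 ^ W * W) * P := Nat.mul_le_mul_right _ (Nat.mul_le_mul_right _ hb)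
      _ = _ := by ring
  set L : (Fin (V - 1) × Fin P) × Fin (2 ^ W) → Set (ℤ_[2] × Bool) :=
    fun i => (step M A)^[lev i] '' cell (M (n + 1)) 0 false with hL
  have hL_cell : ∀ i, L i = cell (M (n + 1)) (orbit M A (lev i)).1 (orbit M A (lev i)).2 := fun i =>
    image_cell M A hM (by have := hlt i 0 (Nat.zero_le _); omega)
  have hcode_lt : ∀ p, orbitCode M A p < 4 := by
    intro p
    have h2 := Bool.toNat_le (orbit M A p).2
    unfold orbitCode
    omega
  set wd : Fin (V - 1) × Fin P → Fin (2 ^ W) → (Fin (5 * K) → Fin 4) :=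
    fun j b k => ⟨orbitCode M A (lev (j, b) + t (k + 1)), hcode_lt _⟩ with hwd
  -- Number of sampling times that fall in the first column of a superblock, where the bit can be
  -- read.
  set D : Fin (V - 1) × Fin P → ℕ := fun j => ((Finset.range K).filter fun i =>
    1 ≤ ((j.2 : ℕ) + t (K + 4 * i)) % P ∧ ((j.2 : ℕ) + t (K + 4 * i)) % P < h).card with hD
  have hentropy := sum_mul_log_two_le_partitionEntropy (towerMeasure M A)
    (sequenceCoding (stepEquiv M A) t parityCode (5 * K))
    (measurable_pi_lambda _ fun k => measurable_parityCode.comp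
      ((measurable_step M A).iterate (t (k + 1))))
    L (fun i => hL_cell i ▸ measurableSet_cell _ _ _)
    (by
      intro i i' hii
      change Disjoint (L i) (L i')
      rw [hL_cell, hL_cell]
      refine Set.disjoint_left.2 fun x h1 h2 => hii (hlev_inj (orbit_injective M A ?_))
      exact Prod.ext (h1.1.symm.trans h2.1) (h1.2.symm.trans h2.2))
    (1 / (2 ^ M (n + 1) * mass M A)) (fun i => measureReal_level) wd
    (by
      rintro j b x ⟨⟨y, c⟩, ⟨hy, hc⟩, rfl⟩
      simp only at hy hc
      subst hc
      funext k
      refine Fin.ext ?_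
      change (parityCode ((step M A)^[t (k + 1)] ((step M A)^[lev (j, b)] (y, false))) : ℕ) =
        orbitCode M A (lev (j, b) + t (k + 1))
      rw [← Function.iterate_add_apply, add_comm (t _)]
      exact parityCode_iterate M A hM hn1 (hlt _ _ (htle k)) hy)
    D
    (by
      rintro ⟨o, u⟩ w
      have hs : ∀ j, t (K + 4 * j) + P ≤ t (K + 4 * (j + 1)) := fun j => hgap _ (by omega)
      have hmono := strictMono_add_div (u := (u : ℕ)) hPpos hs
      have hinj : Function.Injective fun j => (o + 1 : ℕ) + ((u : ℕ) + t (K + 4 * j)) / P :=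
        fun i i' hii => hmono.injective (Nat.add_left_cancel hii)
      have hsK : ∀ i < K, t (K + 4 * i) ≤ V * P := fun i hi =>
        (ht (show K + 4 * i ≤ 5 * K by omega)).trans hbound
      have hidx : ∀ i < K, (o + 1 : ℕ) + ((u : ℕ) + t (K + 4 * i)) / P < W := by
        intro i hi
        have h1 : ((u : ℕ) + t (K + 4 * i)) / P ≤ V := by
          rw [← Nat.lt_succ_iff, Nat.div_lt_iff_lt_mul hPpos, Nat.succ_mul V]
          have := hsK i hi
          have := u.2
          omega
        have := o.2
        omega
      have hcard := card_mul_two_pow_le_of_testBit_eq (W := W)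
        (((Finset.range K).filter fun i => 1 ≤ ((u : ℕ) + t (K + 4 * i)) % P ∧
          ((u : ℕ) + t (K + 4 * i)) % P < h).image
            fun j => (o + 1 : ℕ) + ((u : ℕ) + t (K + 4 * j)) / P)
        (by
          intro i hi
          obtain ⟨j, hj, rfl⟩ := Finset.mem_image.1 hi
          exact Finset.mem_range.2 (hidx j (Finset.mem_range.1 (Finset.mem_filter.1 hj).1)))
        (Finset.univ.filter fun b => wd (o, u) b = w)
        (by
          intro b hb b' hb' i hi
          obtain ⟨j, hj, rfl⟩ := Finset.mem_image.1 hi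
          obtain ⟨hjK, hv1, hv2⟩ := Finset.mem_filter.1 hj
          rw [Finset.mem_range] at hjK
          have heq : wd (o, u) b = wd (o, u) b' :=
            (Finset.mem_filter.1 hb).2.trans (Finset.mem_filter.1 hb').2.symm
          -- Letter `k` of the name is observed at time `t (k + 1)`, hence the index shift.
          have heq' := congrArg Fin.val (congrFun heq ⟨K + 4 * j - 1, by omega⟩)
          simp only [hwd] at heq'
          rw [Nat.sub_add_cancel (by omega)] at heq'
          have key : ∀ b : Fin (2 ^ W),
              orbitCode M A (lev ((o, u), b) + t (K + 4 * j)) =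
              orbitCode M A (((u : ℕ) + t (K + 4 * j)) % P -
                ((b : ℕ).testBit ((o + 1 : ℕ) + ((u : ℕ) + t (K + 4 * j)) / P)).toNat) := by
            intro b
            have hi := hidx j hjK
            have hdm := Nat.div_add_mod ((u : ℕ) + t (K + 4 * j)) P
            have hb : (b : ℕ) + 1 ≤ 2 ^ W := b.2
            generalize ((u : ℕ) + t (K + 4 * j)) / P = d at hi hdm ⊢
            generalize ((u : ℕ) + t (K + 4 * j)) % P = v at hv1 hv2 hdm ⊢
            rw [← wordBit_block (W := W) (by omega) hi, ← orbitCode_superblock hM hn hA hq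
              (by omega) ?_ hv1 hv2]
            · congr 1
              rw [← hh, ← hP]
              simp only [hlev]
              have e : ((b : ℕ) * W + (o + 1 + d)) * P = ((b : ℕ) * W + (o + 1)) * P + P * d := by
                ring
              omega
            · calc _ < (b : ℕ) * W + W := by omega
                _ = ((b : ℕ) + 1) * W := by ring
                _ ≤ 2 ^ W * W := Nat.mul_le_mul_right _ hb
                _ = _ := by ring
          rw [key b, key b'] at heq'
          -- Different bits would give the codes of two consecutive orbit points, which differ.
          have hne := orbitCode_succ_ne M A (((u : ℕ) + t (K + 4 * j)) % P - 1)
          rw [Nat.sub_add_cancel hv1] at hne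
          generalize (b : ℕ).testBit _ = x at heq' ⊢
          generalize (b' : ℕ).testBit _ = x' at heq' ⊢
          cases x <;> cases x' <;> simp only [Bool.toNat_false, Bool.toNat_true, Nat.sub_zero]
            at heq' ⊢
          · exact absurd heq' hne
          · exact absurd heq'.symm hne)
      rw [Finset.card_image_of_injective _ hinj] at hcard
      simpa [hD] using hcard)
  refine le_trans ?_ hentropy
  -- Exchange the sums: each sampling time is good for at least `h - 1` offsets `u`.
  have hDsum : (V - 1) * (K * (h - 1)) ≤ ∑ j, D j := by
    rw [Fintype.sum_prod_type]
    have h1 : ∀ o : Fin (V - 1), K * (h - 1) ≤ ∑ u, D (o, u) := by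
      intro o
      simp only [hD, Finset.card_filter]
      rw [Finset.sum_comm]
      simp only [← Finset.card_filter]
      calc K * (h - 1) = ∑ _i ∈ Finset.range K, (h - 1) := by simp
        _ ≤ _ := Finset.sum_le_sum fun i _ => pred_le_card_filter_add_mod (by omega) _
    calc (V - 1) * (K * (h - 1)) = ∑ _o : Fin (V - 1), K * (h - 1) := by simp
      _ ≤ _ := Finset.sum_le_sum fun o _ => h1 o
  have hDreal : (V / 2 : ℝ) * (K * (h / 2)) ≤ ∑ j, (D j : ℝ) := by
    have h1 : (((V - 1) * (K * (h - 1)) : ℕ) : ℝ) ≤ ((∑ j, D j : ℕ) : ℝ) := by exact_mod_cast hDsum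
    push_cast [Nat.cast_sub (show 1 ≤ V by omega), Nat.cast_sub (show 1 ≤ h by omega)] at h1
    refine le_trans ?_ h1
    have hV' : (2 : ℝ) ≤ V := by exact_mod_cast hV
    have hh' : (2 : ℝ) ≤ h := by exact_mod_cast hQ2.trans hQh
    gcongr <;> linarith
  have hpow : (2 : ℝ) ^ M (n + 1) = 2 * (2 * V * 2 ^ W) * 2 ^ M n := by
    rw [← Nat.cast_ofNat, ← Nat.cast_pow, ← pow_mul_pow_sub M hM, hq, hW]
    push_cast
    ring
  have hmass := mass_le_two M A
  have hmass0 := mass_pos M A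
  have hVpos : (0 : ℝ) < V := by exact_mod_cast (by omega : 0 < V)
  have hQpos : (0 : ℝ) < 2 ^ M n := by positivity
  have hQh' : (2 : ℝ) ^ M n ≤ h := by exact_mod_cast hQh
  have hlog : 0 < Real.log 2 := Real.log_pos one_lt_two
  -- Joint mass of the levels with a given `(o, u)`, bounded by means of `mass M A ≤ 2` and `2 ^ M n
  -- ≤ h`.
  have hcoef : 1 / (8 * V * h : ℝ) ≤
      1 / (2 ^ M (n + 1) * mass M A) * (Fintype.card (Fin (2 ^ W)) : ℝ) := by
    rw [Fintype.card_fin, hpow, Nat.cast_pow, Nat.cast_ofNat]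
    have e : 1 / (2 * (2 * V * 2 ^ W) * 2 ^ M n * mass M A) * (2 : ℝ) ^ W =
        1 / (4 * V * (2 ^ M n * mass M A)) := by
      field_simp
      norm_num
    rw [e]
    refine one_div_le_one_div_of_le (by positivity) ?_
    have : 2 ^ M n * mass M A ≤ h * 2 := mul_le_mul hQh' hmass hmass0.le (by positivity)
    nlinarith
  have hhpos : (0 : ℝ) < h := hQpos.trans_le hQh'
  calc K * Real.log 2 / 32
      = 1 / (8 * V * h : ℝ) * Real.log 2 * ((V / 2 : ℝ) * (K * (h / 2))) := by
        field_simp; norm_num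
    _ ≤ _ := by gcongr

/-! ### Recursive choice of the stages. -/

section Construction

variable (v : ℕ → ℕ)

/-- Exponents `M n` and heights of the towers of the construction in which the tower of height `h`
is cut into superblocks according to `spacerPattern (2 * 2 ^ v h)`. -/
def stage : ℕ → ℕ × ℕ
  | 0 => (0, 1)
  | n + 1 => ((stage n).1 + (1 + (v (stage n).2 + 1) + 2 * 2 ^ v (stage n).2),
      2 * 2 ^ v (stage n).2 * 2 ^ (2 * 2 ^ v (stage n).2) * (2 * (stage n).2 + 1))

theorem stage_strictMono : StrictMono fun n => (stage v n).1 :=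
  strictMono_nat_of_lt_succ fun n => by simp only [stage]; omega

/-- The word length is `2 * 2 ^ v` so that the number of columns is a power of two, as the odometer
requires: the three exponents stand for the pair, the word length and the number of words. -/
theorem two_pow_stage_sub (n : ℕ) : 2 ^ ((stage v (n + 1)).1 - (stage v n).1) =
    2 * (2 * 2 ^ v (stage v n).2 * 2 ^ (2 * 2 ^ v (stage v n).2)) := by
  simp only [stage, Nat.add_sub_cancel_left]
  rw [pow_add, pow_add, pow_add, pow_one]
  ring

theorem height_stage (n : ℕ) : height (fun n => (stage v n).1)
    (fun n => spacerPattern (2 * 2 ^ v (stage v n).2)) n = (stage v n).2 := by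
  induction n with
  | zero => simp [height, stage, pos]
  | succ n ih =>
    have hW : 1 ≤ 2 * 2 ^ v (stage v n).2 := Nat.mul_pos two_pos (by positivity)
    rw [height_superblock (A := fun n => spacerPattern (2 * 2 ^ v (stage v n).2))
      (stage_strictMono v) rfl hW (two_pow_stage_sub v n), ih]
    simp only [stage]

end Construction

/-! ### From growth of the sequence to positive sequence entropy. -/

/-- A rank one system with positive sequence entropy along `t`, provided that `t` has gaps
comparable to `h` from the index `K h` on, and is of order `K h * h` near that index. -/
theorem exists_rankOneSystem (t : ℕ → ℕ) (ht : Monotone t) (K : ℕ → ℕ) (C : ℕ)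
    (hK : ∀ h ≥ 1, 1 ≤ K h) (hKtop : Tendsto K atTop atTop)
    (hgap : ∀ h ≥ 1, ∀ k ≥ K h, t k + (2 * h + 1) ≤ t (k + 4))
    (hbound : ∀ h ≥ 1, t (5 * K h) ≤ C * K h * h) :
    ∃ (X : Type) (_ : MeasurableSpace X) (_ : StandardBorelSpace X) (μ : Measure X)
      (T : X ≃ᵐ X) (h : ℕ → ℕ), IsRankOneSystem μ T h ∧ 0 < sequenceEntropy μ T t ∧
      ∀ n, 1 ≤ h n ∧
        Real.log (h (n + 1)) ≤ 16 * (C + 2) * K (h n) + Real.log (h n) := by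
  -- `V = 2 ^ v h` is `C * K h + 2` rounded up to a power of two: large enough to contain the
  -- sampling window, and at most twice that number, which controls the next height.
  set v : ℕ → ℕ := fun h => Nat.clog 2 (C * K h + 2) with hv
  set M : ℕ → ℕ := fun n => (stage v n).1 with hM
  set A : ℕ → ℕ → Bool := fun n => spacerPattern (2 * 2 ^ v (stage v n).2) with hA
  have hMmono : StrictMono M := stage_strictMono v
  have hh : ∀ n, height M A n = (stage v n).2 := height_stage v
  have hh1 : ∀ n, 1 ≤ height M A n := fun n => Nat.succ_pos _
  have hVlow : ∀ h, C * K h + 2 ≤ 2 ^ v h := fun h => Nat.le_pow_clog one_lt_two _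
  have hVup : ∀ h, 2 ^ v h ≤ 2 * (C * K h + 2) := by
    intro h
    have h1 : 0 < v h := Nat.clog_pos one_lt_two (by omega)
    have h2 := Nat.pow_pred_clog_lt_self one_lt_two (x := C * K h + 2) (by omega)
    rw [← Nat.succ_pred_eq_of_pos h1, pow_succ, mul_comm]
    exact Nat.mul_le_mul_left _ h2.le
  refine ⟨ℤ_[2] × Bool, inferInstance, inferInstance, towerMeasure M A, stepEquiv M A, height M A,
    isRankOneSystem M A rfl hMmono, ?_, fun n => ⟨hh1 n, ?_⟩⟩
  · have hentropy : ∀ n ≥ 1, K (height M A n) * Real.log 2 / 32 ≤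
        partitionEntropy (towerMeasure M A)
          (sequenceCoding (stepEquiv M A) t parityCode (5 * K (height M A n))) := by
      intro n hn
      refine partitionEntropy_sequenceCoding_ge (V := 2 ^ v (stage v n).2) ?_ hMmono
        (hn.trans hMmono.le_apply) rfl (two_pow_stage_sub v n) ht (hK _ (hh1 n))
        (hgap _ (hh1 n)) ?_
      · exact le_trans (by omega) (hVlow _)
      · refine (hbound _ (hh1 n)).trans (Nat.mul_le_mul ?_ (by omega))
        rw [hh]
        exact le_trans (by omega) (hVlow _)
    have hNtop : Tendsto (fun n => 5 * K (height M A n)) atTop atTop := by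
      refine Tendsto.const_mul_atTop' (by norm_num) (hKtop.comp ?_)
      refine tendsto_atTop_mono (fun n => ?_) tendsto_id
      exact (Nat.lt_two_pow_self.le.trans
        (Nat.pow_le_pow_right two_pos hMmono.le_apply)).trans (pow_le_height M A n)
    -- Entropy `K * log 2 / 32` divided by the `5 * K` observations.
    have hc : (0 : EReal) < ((Real.log 2 / 160 : ℝ) : EReal) := by
      rw [EReal.coe_pos]
      have := Real.log_pos one_lt_two
      positivity
    refine hc.trans_le (le_trans ?_ (le_iSup_of_le 4 (le_iSup_of_le parityCode
      (le_iSup_of_le measurable_parityCode le_rfl))))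
    refine le_limsup_of_frequently_le' ?_
    refine hNtop.frequently (Eventually.frequently ?_)
    filter_upwards [eventually_ge_atTop 1] with n hn
    rw [EReal.coe_le_coe_iff]
    have hKpos : (0 : ℝ) < K (height M A n) := by exact_mod_cast hK _ (hh1 n)
    have := hentropy n hn
    rw [one_div, inv_mul_eq_div, le_div_iff₀ (by push_cast; positivity)]
    push_cast
    linarith
  · have hsucc : height M A (n + 1) = 2 * 2 ^ v (height M A n) *
        2 ^ (2 * 2 ^ v (height M A n)) * (2 * height M A n + 1) := by
      rw [hh, hh]; rfl
    rw [hsucc]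
    have hup := hVup (height M A n)
    have hlow := hVlow (height M A n)
    have hK1 := hK _ (hh1 n)
    have hn1 := hh1 n
    generalize height M A n = h at *
    generalize K h = k at *
    generalize 2 ^ v h = V at *
    have hk' : (1 : ℝ) ≤ k := by exact_mod_cast hK1
    have hh' : (1 : ℝ) ≤ h := by exact_mod_cast hn1
    have hup' : (V : ℝ) ≤ 2 * (C * k + 2) := by exact_mod_cast hup
    have hlow' : (C : ℝ) * k + 2 ≤ V := by exact_mod_cast hlow
    have hC : (0 : ℝ) ≤ C * k := by positivity
    have hV : (0 : ℝ) < V := by linarith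
    push_cast
    rw [Real.log_mul (by positivity) (by positivity), Real.log_mul (by positivity) (by positivity),
      Real.log_pow]
    have h1 : Real.log (2 * V) ≤ 2 * V := (Real.log_le_sub_one_of_pos (by positivity)).trans
      (by linarith)
    have h2 : Real.log 2 ≤ 1 := (Real.log_le_sub_one_of_pos two_pos).trans (by norm_num)
    have h3 : Real.log (2 * h + 1) ≤ 2 + Real.log h := by
      calc Real.log (2 * h + 1) ≤ Real.log (3 * h) :=
            Real.log_le_log (by positivity) (by linarith)
        _ = Real.log 3 + Real.log h := Real.log_mul (by norm_num) (by positivity)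
        _ ≤ _ := by
          have := Real.log_le_sub_one_of_pos (show (0 : ℝ) < 3 by norm_num)
          linarith
    have h4 : ((2 * V : ℕ) : ℝ) * Real.log 2 ≤ 2 * V := by
      push_cast
      nlinarith
    have h5 : (16 : ℝ) * (C + 2) * k = 16 * (C * k) + 32 * k := by ring
    linarith

/-- Version of `exists_rankOneSystem` for the sequence `⌊k * g k⌋`. -/
theorem exists_rankOneSystem_floor (g : ℕ → ℝ) (hg0 : ∀ k, 0 ≤ g k)
    (hg : ∀ k l, 1 ≤ k → k ≤ l → g k ≤ g l) (K : ℕ → ℕ) (c : ℝ)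
    (hK : ∀ h ≥ 1, 1 ≤ K h) (hKtop : Tendsto K atTop atTop) (hKg : ∀ h : ℕ, 1 ≤ h → (h : ℝ) ≤ g (K h))
    (hgK : ∀ h : ℕ, 1 ≤ h → g (5 * K h) ≤ c * h) (Φ : ℕ → ℝ) (hΦ : ∀ h ≥ 1, 0 < Φ h)
    (hKΦ : ∀ h : ℕ, 1 ≤ h → K h ≤ c * Φ h) (hlog : ∀ h : ℕ, 1 ≤ h → Real.log h ≤ c * Φ h) :
    ∃ (X : Type) (_ : MeasurableSpace X) (_ : StandardBorelSpace X) (μ : Measure X)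
      (T : X ≃ᵐ X) (h : ℕ → ℕ), IsRankOneSystem μ T h ∧
      0 < sequenceEntropy μ T (fun k => ⌊k * g k⌋₊) ∧
      limsup (fun n => ((Real.log (h (n + 1)) / Φ (h n) : ℝ) : EReal)) atTop < ⊤ := by
  have ht : Monotone fun k : ℕ => ⌊k * g k⌋₊ := by
    intro k l hkl
    rcases Nat.eq_zero_or_pos k with rfl | hk
    · simp
    · exact Nat.floor_le_floor (mul_le_mul (by exact_mod_cast hkl) (hg k l hk hkl) (hg0 k)
        (by positivity))
  obtain ⟨X, i₁, i₂, μ, T, h, hT, hent, hlogh⟩ := exists_rankOneSystem _ ht K ⌈5 * c⌉₊ hK hKtop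
    (by
      intro h hh k hk
      have hk1 : 1 ≤ k := (hK h hh).trans hk
      have h1 : (h : ℝ) ≤ g k := (hKg h hh).trans (hg _ _ (hK h hh) hk)
      have h2 := hg k (k + 4) hk1 (by omega)
      -- Four indices add at least `4 * g k ≥ 4 * h`, which covers `2 * h + 1` because `h ≥ 1`.
      calc ⌊k * g k⌋₊ + (2 * h + 1) ≤ ⌊k * g k⌋₊ + 4 * h := by omega
        _ = ⌊k * g k + (4 * h : ℕ)⌋₊ :=
          (Nat.floor_add_natCast (mul_nonneg k.cast_nonneg (hg0 k)) _).symm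
        _ ≤ _ := by
          refine Nat.floor_le_floor ?_
          push_cast
          nlinarith [hg0 k, (Nat.cast_nonneg k : (0 : ℝ) ≤ k)])
    (by
      intro h hh
      refine Nat.floor_le_of_le ?_
      have h1 := hgK h hh
      have h2 : 5 * c ≤ ⌈5 * c⌉₊ := Nat.le_ceil _
      have h3 : (0 : ℝ) ≤ K h * h := by positivity
      push_cast
      calc 5 * (K h : ℝ) * g (5 * K h) ≤ 5 * (K h : ℝ) * (c * h) := by gcongr
        _ = 5 * c * (K h * h) := by ring
        _ ≤ ⌈5 * c⌉₊ * (K h * h) := by gcongr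
        _ = _ := by ring)
  refine ⟨X, i₁, i₂, μ, T, h, hT, hent, ?_⟩
  refine lt_of_le_of_lt (limsup_le_of_le (h := Eventually.of_forall fun n => ?_))
    (EReal.coe_lt_top (16 * (⌈5 * c⌉₊ + 2) * c + c))
  obtain ⟨h1, h2⟩ := hlogh n
  rw [EReal.coe_le_coe_iff, div_le_iff₀ (hΦ _ h1)]
  have h3 := hKΦ _ h1
  have h4 := hlog _ h1
  have h5 : (0 : ℝ) ≤ 16 * (⌈5 * c⌉₊ + 2) := by positivity
  calc _ ≤ _ := h2
    _ ≤ 16 * (⌈5 * c⌉₊ + 2) * (c * Φ (h n)) + c * Φ (h n) := by gcongr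
    _ = _ := by ring

end TwoAdicTower

/-! ### The two explicit families of sequences. -/

theorem natCeil_le_two_mul {x : ℝ} (hx : 1 ≤ x) : (⌈x⌉₊ : ℝ) ≤ 2 * x := by
  have := Nat.ceil_lt_add_one (zero_le_one.trans hx)
  linarith

theorem exists_rankOneSystem_rpow (α β : ℝ) (hβ : 0 < β) (h : 1 + 1 / β ≤ α) :
    ∃ (X : Type) (_ : MeasurableSpace X) (_ : StandardBorelSpace X) (μ : Measure X)
      (T : X ≃ᵐ X) (h : ℕ → ℕ),
      IsRankOneSystem μ T h ∧
      0 < sequenceEntropy μ T (fun n : ℕ => ⌊(n : ℝ) ^ α⌋₊) ∧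
      limsup (fun n : ℕ =>
        ((Real.log (h (n + 1) : ℝ) / (h n : ℝ) ^ β : ℝ) : EReal)) atTop < ⊤ := by
  have hβ' : 0 < 1 / β := by positivity
  set γ := α - 1 with hγ
  have hγ0 : 0 < γ := by linarith
  have hγβ : γ⁻¹ ≤ β := by
    rw [inv_le_comm₀ hγ0 hβ, ← one_div]
    linarith
  have ht : (fun n : ℕ => ⌊(n : ℝ) ^ α⌋₊) = fun n : ℕ => ⌊(n : ℝ) * (n : ℝ) ^ γ⌋₊ := by
    funext n
    rcases Nat.eq_zero_or_pos n with rfl | hn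
    · simp [Real.zero_rpow (show α ≠ 0 by linarith)]
    · have hn' : (0 : ℝ) < n := by exact_mod_cast hn
      rw [show α = 1 + γ by ring, Real.rpow_add hn', Real.rpow_one]
  rw [ht]
  have h1 : ∀ h : ℕ, 1 ≤ h → (1 : ℝ) ≤ (h : ℝ) ^ γ⁻¹ := fun h hh =>
    Real.one_le_rpow (by exact_mod_cast hh) (by positivity)
  have hle : ∀ h : ℕ, 1 ≤ h → (h : ℝ) ^ γ⁻¹ ≤ (h : ℝ) ^ β := fun h hh =>
    Real.rpow_le_rpow_of_exponent_le (by exact_mod_cast hh) hγβ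
  have hinv : ∀ h : ℕ, ((h : ℝ) ^ γ⁻¹) ^ γ = h := fun h => by
    rw [← Real.rpow_mul h.cast_nonneg, inv_mul_cancel₀ hγ0.ne', Real.rpow_one]
  refine TwoAdicTower.exists_rankOneSystem_floor (fun n => (n : ℝ) ^ γ) (fun n => by positivity)
    (fun k l _ hkl => Real.rpow_le_rpow k.cast_nonneg (by exact_mod_cast hkl) hγ0.le)
    -- `K h` solves `K ^ γ = h` up to rounding. In the constant, `10 ^ γ` bounds `g (5 * K h) / h`,
    -- `2` pays for the ceiling, and `1 / β` for `log h ≤ h ^ β / β`.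
    (fun h => ⌈(h : ℝ) ^ γ⁻¹⌉₊) (10 ^ γ + 2 + 1 / β) ?_ ?_ ?_ ?_ (fun h => (h : ℝ) ^ β) ?_ ?_ ?_
  · intro h hh
    exact Nat.one_le_ceil_iff.2 (by linarith [h1 h hh])
  · exact tendsto_nat_ceil_atTop.comp
      ((tendsto_rpow_atTop (inv_pos.2 hγ0)).comp tendsto_natCast_atTop_atTop)
  · intro h hh
    calc (h : ℝ) = ((h : ℝ) ^ γ⁻¹) ^ γ := (hinv h).symm
      _ ≤ _ := Real.rpow_le_rpow (by positivity) (Nat.le_ceil _) hγ0.le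
  · intro h hh
    push_cast
    calc (5 * (⌈(h : ℝ) ^ γ⁻¹⌉₊ : ℝ)) ^ γ ≤ (10 * (h : ℝ) ^ γ⁻¹) ^ γ := by
          refine Real.rpow_le_rpow (by positivity) ?_ hγ0.le
          linarith [natCeil_le_two_mul (h1 h hh)]
      _ = 10 ^ γ * h := by rw [Real.mul_rpow (by norm_num) (by positivity), hinv]
      _ ≤ _ := by gcongr; linarith
  · intro h hh
    have : (0 : ℝ) < h := by exact_mod_cast hh
    positivity
  · intro h hh
    calc (⌈(h : ℝ) ^ γ⁻¹⌉₊ : ℝ) ≤ 2 * (h : ℝ) ^ γ⁻¹ := natCeil_le_two_mul (h1 h hh)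
      _ ≤ 2 * (h : ℝ) ^ β := by linarith [hle h hh]
      _ ≤ _ := by
        gcongr
        have : (0 : ℝ) < 10 ^ γ := by positivity
        linarith
  · intro h hh
    calc Real.log h ≤ (h : ℝ) ^ β / β := Real.log_le_rpow_div h.cast_nonneg hβ
      _ = 1 / β * (h : ℝ) ^ β := by ring
      _ ≤ _ := by
        gcongr
        have : (0 : ℝ) < 10 ^ γ := by positivity
        linarith

theorem exists_rankOneSystem_mul_log_rpow (α β : ℝ) (hα : 0 < α) (hβ : 0 < β) (h : 1 / β ≤ α) :
    ∃ (X : Type) (_ : MeasurableSpace X) (_ : StandardBorelSpace X) (μ : Measure X)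
      (T : X ≃ᵐ X) (h : ℕ → ℕ),
      IsRankOneSystem μ T h ∧
      0 < sequenceEntropy μ T (fun n : ℕ => ⌊(n : ℝ) * Real.log (n : ℝ) ^ α⌋₊) ∧
      limsup (fun n : ℕ =>
        ((Real.log (h (n + 1) : ℝ) / Real.exp ((h n : ℝ) ^ β) : ℝ) : EReal)) atTop < ⊤ := by
  have hαβ : α⁻¹ ≤ β := by
    rw [inv_le_comm₀ hα hβ, ← one_div]
    exact h
  have h1 : ∀ h : ℕ, 1 ≤ h → (1 : ℝ) ≤ (h : ℝ) ^ α⁻¹ := fun h hh =>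
    Real.one_le_rpow (by exact_mod_cast hh) (by positivity)
  have h1e : ∀ h : ℕ, (1 : ℝ) ≤ Real.exp ((h : ℝ) ^ α⁻¹) := fun h =>
    Real.one_le_exp (by positivity)
  have hle : ∀ h : ℕ, 1 ≤ h → Real.exp ((h : ℝ) ^ α⁻¹) ≤ Real.exp ((h : ℝ) ^ β) := fun h hh =>
    Real.exp_le_exp.2 (Real.rpow_le_rpow_of_exponent_le (by exact_mod_cast hh) hαβ)
  have hinv : ∀ h : ℕ, ((h : ℝ) ^ α⁻¹) ^ α = h := fun h => by
    rw [← Real.rpow_mul h.cast_nonneg, inv_mul_cancel₀ hα.ne', Real.rpow_one]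
  have hlog10 : 0 < Real.log 10 := Real.log_pos (by norm_num)
  have hc : (0 : ℝ) < (1 + Real.log 10) ^ α := by positivity
  have hβ' : 0 < 1 / β := by positivity
  refine TwoAdicTower.exists_rankOneSystem_floor (fun n => Real.log (n : ℝ) ^ α)
    (fun n => Real.rpow_nonneg (Real.log_natCast_nonneg n) _)
    (fun k l hk hkl => Real.rpow_le_rpow (Real.log_natCast_nonneg k)
      (Real.log_le_log (by exact_mod_cast hk) (by exact_mod_cast hkl)) hα.le)
    -- `K h` solves `(log K) ^ α = h` up to rounding. The first summand of the constant absorbs the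
    -- factor `5` and the ceiling, which only add `log 10` to the logarithm.
    (fun h => ⌈Real.exp ((h : ℝ) ^ α⁻¹)⌉₊) ((1 + Real.log 10) ^ α + 2 + 1 / β) ?_ ?_ ?_ ?_
    (fun h => Real.exp ((h : ℝ) ^ β)) ?_ ?_ ?_
  · intro h _
    exact Nat.one_le_ceil_iff.2 (Real.exp_pos _)
  · exact tendsto_nat_ceil_atTop.comp (Real.tendsto_exp_atTop.comp
      ((tendsto_rpow_atTop (inv_pos.2 hα)).comp tendsto_natCast_atTop_atTop))
  · intro h hh
    calc (h : ℝ) = ((h : ℝ) ^ α⁻¹) ^ α := (hinv h).symm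
      _ ≤ _ := by
        refine Real.rpow_le_rpow (by positivity) ?_ hα.le
        rw [Real.le_log_iff_exp_le (lt_of_lt_of_le (Real.exp_pos _) (Nat.le_ceil _))]
        exact Nat.le_ceil _
  · intro h hh
    have hK1 : (1 : ℝ) ≤ ⌈Real.exp ((h : ℝ) ^ α⁻¹)⌉₊ := (h1e h).trans (Nat.le_ceil _)
    have hlogK : Real.log (5 * (⌈Real.exp ((h : ℝ) ^ α⁻¹)⌉₊ : ℝ)) ≤
        (1 + Real.log 10) * (h : ℝ) ^ α⁻¹ := by
      calc _ ≤ Real.log (10 * Real.exp ((h : ℝ) ^ α⁻¹)) := by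
            refine Real.log_le_log (by linarith) ?_
            linarith [natCeil_le_two_mul (h1e h)]
        _ = Real.log 10 + (h : ℝ) ^ α⁻¹ := by
            rw [Real.log_mul (by norm_num) (Real.exp_pos _).ne', Real.log_exp]
        _ ≤ _ := by nlinarith [h1 h hh]
    push_cast
    calc _ ≤ ((1 + Real.log 10) * (h : ℝ) ^ α⁻¹) ^ α :=
          Real.rpow_le_rpow (Real.log_nonneg (by linarith)) hlogK hα.le
      _ = (1 + Real.log 10) ^ α * h := by
          rw [Real.mul_rpow (by positivity) (by positivity), hinv]
      _ ≤ _ := by gcongr; linarith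
  · intro h _
    exact Real.exp_pos _
  · intro h hh
    calc (⌈Real.exp ((h : ℝ) ^ α⁻¹)⌉₊ : ℝ) ≤ 2 * Real.exp ((h : ℝ) ^ α⁻¹) :=
          natCeil_le_two_mul (h1e h)
      _ ≤ 2 * Real.exp ((h : ℝ) ^ β) := by linarith [hle h hh]
      _ ≤ _ := by gcongr; linarith
  · intro h hh
    calc Real.log h ≤ (h : ℝ) ^ β / β := Real.log_le_rpow_div h.cast_nonneg hβ
      _ = 1 / β * (h : ℝ) ^ β := by ring
      _ ≤ 1 / β * Real.exp ((h : ℝ) ^ β) := by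
        gcongr
        linarith [Real.add_one_le_exp ((h : ℝ) ^ β)]
      _ ≤ _ := by gcongr; linarith

theorem mainTheorem4 :
    (∀ α β : ℝ, 0 < α → 0 < β → 1 + 1 / β ≤ α →
      ∃ (X : Type) (_ : MeasurableSpace X) (_ : StandardBorelSpace X) (μ : Measure X)
        (T : X ≃ᵐ X) (h : ℕ → ℕ),
        IsRankOneSystem μ T h ∧
        0 < sequenceEntropy μ T (fun n : ℕ => ⌊(n : ℝ) ^ α⌋₊) ∧
        limsup (fun n : ℕ =>
          ((Real.log (h (n + 1) : ℝ) / (h n : ℝ) ^ β : ℝ) : EReal)) atTop < ⊤) ∧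
    (∀ α β : ℝ, 0 < α → 0 < β → 1 / β ≤ α →
      ∃ (X : Type) (_ : MeasurableSpace X) (_ : StandardBorelSpace X) (μ : Measure X)
        (T : X ≃ᵐ X) (h : ℕ → ℕ),
        IsRankOneSystem μ T h ∧
        0 < sequenceEntropy μ T (fun n : ℕ => ⌊(n : ℝ) * Real.log (n : ℝ) ^ α⌋₊) ∧
        limsup (fun n : ℕ =>
          ((Real.log (h (n + 1) : ℝ) / Real.exp ((h n : ℝ) ^ β) : ℝ) : EReal)) atTop < ⊤) :=
  ⟨fun α β _ hβ h => exists_rankOneSystem_rpow α β hβ h,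
    fun α β hα hβ h => exists_rankOneSystem_mul_log_rpow α β hα hβ h⟩
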